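/- Setting. Let $\mathcal X=\{x\in\mathbb R^d:\|x\|_2\le 1\}$, let $\sigma(u)=\max\{0,u\}$ act componentwise, and let $m\ge1$, $2\le S\le d$, $0<\alpha\le 1$, $J=\lceil (md-1)/(S-1)\rceil$, $d_j=d+jS$. Networks. For a filter $w=(w_0,\dots,w_S)$ (with $w_k=0$ for $k\notin\{0,\dots,S\}$) acting on $\mathbb R^D$, let $T^w=(w_{i-k})_{1\le i\le D+S,\,1\le k\le D}$. Put $h^{(0)}(x)=x$, $h^{(j)}(x)=\sigma(T^{w^{(j)}}h^{(j-1)}(x)-b^{(j)})\in\mathbb R^{d_j}$ for $1\le j\le J$, where $b^{(j)}_{S+1}=\dots=b^{(j)}_{d_j-S}$, and $h^{(J+1)}(x)=\sigma(F h^{(J)}(x)-b^{(J+1)})\in\mathbb R^{m(2N+3)}$, where $F_{(j-1)(2N+3)+i,\;jd}=1$ for $1\le j\le m$, $1\le i\le 2N+3$, and all other entries of $F$ are $0$. For $B>0$ let $\mathcal H=\mathcal H(J,B,S,N)$ be the set of all functions $x\mapsto c\cdot h^{(J+1)}(x)$ on $\mathcal X$ with $\|w^{(j)}\|_\infty\le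 B$ $(1\le j\le J)$, $\|b^{(j)}\|_\infty\le 2((S+1)B)^j$ $(1\le j\le J+1)$ and $\|c\|_\infty\le NB$. Target and data. Let $\rho$ be a Borel probability measure on $\mathcal X\times\mathbb R$ with $|y|\le M$ almost surely, with marginal $\rho_{\mathcal X}$ on $\mathcal X$ and regression function $f_\rho(x)=\int y\,d\rho(y|x)$. Assume that (a version of) $f_\rho$ lies in $\Theta(m,\alpha,G,L)$, i.e. $f_\rho(x)=\sum_{j=1}^m g_j(\xi_j\cdot x)$ with $0<\|\xi_j\|_2\le1$ and functions $g_j$ on $[-1,1]$ satisfying $|g_j|\le G$ and $|g_j(u)-g_j(v)|\le L|u-v|^\alpha$. Let $(\xi_m)_l$ be the first nonzero coordinate of $\xi_m$ and let $$B\ \ge\ \max\Big\{2^S\Big(1+\Big|\frac1{(\xi_m)_l}\Big|\Big)^S,\ 4G\Big\}.$$ For a sample $D=\{(x_i,y_i)\}_{i=1}^n$ drawn i.i.d. from $\rho$ let $f_{D,\mathcal H}$ be a minimizer over $f\in\mathcal H$ of $\frac1n\sum_{i=1}^n(f(x_i)-y_i)^2$, and let $\pi_M$ denote the truncation of the values of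 a function to $[-M,M]$. Theorem. There is a constant $C$, depending only on $S,d,m,M,\alpha,B,L$ (in particular not on $n$ and $N$), such that for all integers $n\ge1$, $N\ge1$ $$\mathbb E\big\|\pi_Mf_{D,\mathcal H}-f_\rho\big\|_{L^2(\rho_{\mathcal X})}^2\ \le\ C\max\Big\{N^{-2\alpha},\frac{N\log N}{n}\Big\},$$ and, if $N=\lceil n^{1/(1+2\alpha)}\rceil$ and $n\ge2$, $$\mathbb E\big\|\pi_Mf_{D,\mathcal H}-f_\rho\big\|_{L^2(\rho_{\mathcal X})}^2\ \le\ C\,n^{-\frac{2\alpha}{1+2\alpha}}\log n .$$ -/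

import Mathlib

open MeasureTheory

noncomputable section

/-- The closed Euclidean unit ball of `ℝ^d`, the input space. -/
abbrev UnitBall (d : ℕ) : Type :=
  Metric.closedBall (0 : EuclideanSpace ℝ (Fin d)) 1

/-! ### The convolutional networks -/

/-- The ReLU activation, acting componentwise. -/
def reluVec {ι : Type} (v : ι → ℝ) : ι → ℝ := fun i => max 0 (v i)

/-- The `(D + S) × D` Toeplitz matrix of a filter `w` supported in `{0, …, S}`:
its `(i, k)` entry is `w (i - k)`, read as `0` unless `0 ≤ i - k ≤ S`. -/
def toeplitz (S D : ℕ) (w : Fin (S + 1) → ℝ) : Matrix (Fin (D + S)) (Fin D) ℝ :=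
  Matrix.of fun i k =>
    if h : (k : ℕ) ≤ (i : ℕ) ∧ (i : ℕ) - (k : ℕ) ≤ S then
      w ⟨(i : ℕ) - (k : ℕ), Nat.lt_succ_of_le h.2⟩
    else 0

/-- The widths of the layers: layer `j` has `d + j S` units. -/
def layerWidth (d S : ℕ) : ℕ → ℕ
  | 0 => d
  | j + 1 => layerWidth d S j + S

/-- The output of the first `j` convolutional layers. The filter and the bias vector of
layer `j + 1` are `w j` and `b j`. -/
def convOutput (d S : ℕ) (w : ℕ → Fin (S + 1) → ℝ)
    (b : (j : ℕ) → Fin (layerWidth d S (j + 1)) → ℝ) (x : Fin d → ℝ) :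
    (j : ℕ) → Fin (layerWidth d S j) → ℝ
  | 0 => x
  | j + 1 => reluVec fun i =>
      (toeplitz S (layerWidth d S j) (w j)).mulVec (convOutput d S w b x j) i - b j i

/-- The matrix of the fully connected layer. Its rows come in `m` blocks of `2N + 3` rows; every
row of the `j`-th block (`1 ≤ j ≤ m`) has a single nonzero entry, a `1` in column `j d`
(columns counted from `1`). -/
def fullMatrix (d S J m N : ℕ) :
    Matrix (Fin m × Fin (2 * N + 3)) (Fin (layerWidth d S J)) ℝ :=
  Matrix.of fun r k => if (k : ℕ) + 1 = ((r.1 : ℕ) + 1) * d then 1 else 0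

/-- The function `x ↦ c · h^{(J+1)}(x)` computed by `J` convolutional layers followed by the
fully connected layer with bias vector `β`. -/
def networkFun (d S J m N : ℕ) (w : ℕ → Fin (S + 1) → ℝ)
    (b : (j : ℕ) → Fin (layerWidth d S (j + 1)) → ℝ)
    (β c : Fin m × Fin (2 * N + 3) → ℝ) (x : UnitBall d) : ℝ :=
  c ⬝ᵥ reluVec
    ((fullMatrix d S J m N).mulVec
      (convOutput d S w b (fun i => (x : EuclideanSpace ℝ (Fin d)) i) J) - β)

/-- The hypothesis space `𝓗(J, B, S, N)`. The bias vectors of the convolutional layers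
are constant on the entries `S + 1, …, d_j - S` (counted from `1`). -/
def hypothesisSpace (d S J m N : ℕ) (B : ℝ) : Set (UnitBall d → ℝ) :=
  {f | ∃ (w : ℕ → Fin (S + 1) → ℝ) (b : (j : ℕ) → Fin (layerWidth d S (j + 1)) → ℝ)
      (β c : Fin m × Fin (2 * N + 3) → ℝ),
    (∀ j < J, ∀ i, |w j i| ≤ B) ∧
    (∀ j < J, ∀ i, |b j i| ≤ 2 * (((S : ℝ) + 1) * B) ^ (j + 1)) ∧
    (∀ j < J, ∀ i i' : Fin (layerWidth d S (j + 1)),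
      S ≤ (i : ℕ) → (i : ℕ) + S < layerWidth d S (j + 1) →
      S ≤ (i' : ℕ) → (i' : ℕ) + S < layerWidth d S (j + 1) → b j i = b j i') ∧
    (∀ r, |β r| ≤ 2 * (((S : ℝ) + 1) * B) ^ (J + 1)) ∧
    (∀ r, |c r| ≤ (N : ℝ) * B) ∧
    f = networkFun d S J m N w b β c}

/-- The number of convolutional layers, `⌈(m d - 1) / (S - 1)⌉`. -/
def convDepth (d S m : ℕ) : ℕ := ⌈((m : ℝ) * (d : ℝ) - 1) / ((S : ℝ) - 1)⌉₊

/-! ### Additive ridge functions -/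

/-- `f` is the additive ridge function `x ↦ ∑ j, g j (ξ j · x)`, with directions
`0 < ‖ξ j‖ ≤ 1` and profiles `g j` on `[-1, 1]` bounded by `G` and Lipschitz-`α` with
constant `L`. The class `Θ(m, α, G, L)` consists of all `f` for which such `ξ` and `g` exist. -/
structure IsAdditiveRidge {d m : ℕ} (α G L : ℝ) (ξ : Fin m → EuclideanSpace ℝ (Fin d))
    (g : Fin m → ℝ → ℝ) (f : UnitBall d → ℝ) : Prop where
  dir_pos : ∀ j, 0 < ‖ξ j‖
  dir_le : ∀ j, ‖ξ j‖ ≤ 1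
  bound : ∀ j, ∀ u ∈ Set.Icc (-1 : ℝ) 1, |g j u| ≤ G
  lipschitz : ∀ j, ∀ u ∈ Set.Icc (-1 : ℝ) 1, ∀ v ∈ Set.Icc (-1 : ℝ) 1,
    |g j u - g j v| ≤ L * |u - v| ^ α
  eq_sum : ∀ x : UnitBall d, f x = ∑ j, g j (inner ℝ (ξ j) (x : EuclideanSpace ℝ (Fin d)))

/-- `B` is at least `max {2^S (1 + |1 / (ξ_m)_l|)^S, 4 G}`, where `(ξ_m)_l` is the first nonzero
coordinate of the last direction `ξ_m`. -/
def IsParameterBound {d m : ℕ} (S : ℕ) (G : ℝ) (ξ : Fin m → EuclideanSpace ℝ (Fin d))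
    (B : ℝ) : Prop :=
  ∃ (k : Fin m) (l : Fin d), (k : ℕ) + 1 = m ∧ ξ k l ≠ 0 ∧ (∀ i < l, ξ k i = 0) ∧
    max ((2 : ℝ) ^ S * (1 + |1 / ξ k l|) ^ S) (4 * G) ≤ B

/-! ### The statistical setting -/

/-- `f` is (a version of) the regression function `x ↦ ∫ y dρ(y | x)` of `ρ`; as a conditional
expectation it is determined up to null sets of the marginal `ρ_X`. -/
def IsRegressionFunction {d : ℕ} (ρ : Measure (UnitBall d × ℝ)) [IsFiniteMeasure ρ]
    (f : UnitBall d → ℝ) : Prop :=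
  f =ᵐ[ρ.fst] fun x => ∫ y, y ∂(ρ.condKernel x)

/-- The projection of the values of `f` onto `[-M, M]`. -/
def clip {X : Type} (M : ℝ) (f : X → ℝ) : X → ℝ := fun x => max (-M) (min M (f x))

/-- The empirical risk of `f` on the sample `D`. -/
def empiricalRisk {X : Type} {n : ℕ} (D : Fin n → X × ℝ) (f : X → ℝ) : ℝ :=
  (1 / (n : ℝ)) * ∑ i, (f (D i).1 - (D i).2) ^ 2

/-- `fD` selects, for every sample `D` of size `n`, an empirical risk minimizer over `H`. -/
def IsEmpiricalMinimizer {X : Type} {n : ℕ} (H : Set (X → ℝ))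
    (fD : (Fin n → X × ℝ) → X → ℝ) : Prop :=
  ∀ D, fD D ∈ H ∧ ∀ h ∈ H, empiricalRisk D (fD D) ≤ empiricalRisk D h

/-- The squared distance `‖π_M fD - f‖²` in `L²(ρ_X)`, as a function of the sample. -/
def clippedError {d n : ℕ} (ρ : Measure (UnitBall d × ℝ)) (M : ℝ) (f : UnitBall d → ℝ)
    (fD : (Fin n → UnitBall d × ℝ) → UnitBall d → ℝ) (D : Fin n → UnitBall d × ℝ) : ℝ :=
  ∫ x, (clip M (fD D) x - f x) ^ 2 ∂ρ.fst

/-- The law of `n` independent observations drawn from `ρ`. -/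
def sampleLaw {d : ℕ} (ρ : Measure (UnitBall d × ℝ)) (n : ℕ) :
    Measure (Fin n → UnitBall d × ℝ) :=
  Measure.pi fun _ => ρ

end

/-! The error splits into approximation and estimation, both governed by `N` alone, since the depth
`convDepth d S m` is fixed.

Approximation: vectors are read as coefficient sequences of polynomials, so a Toeplitz layer
multiplies by the filter's polynomial. Concatenating the reversed directions gives one long filter
whose product with the input carries every `ξ j · x` at a known coefficient. Over `ℝ` this
polynomial splits into factors of degree at most `S`, one per layer (`exists_filters`); Cauchy's
root bound controls their coefficients by the leading one, which is the first nonzero coordinate of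
the last direction. Large biases keep every ReLU in its linear range (`convOutput_linearBias`). The
fully connected layer then interpolates each `g j` by a linear spline, with error `L * N ^ (-α)`
(`exists_network_approx`).

Estimation: networks are Lipschitz in their parameters, and only about `4 * m * N` parameters vary
with `N`, so a grid of parameters is a net of log-cardinality `N` times logarithms (`exists_net`).
The excess square loss has second moment bounded by a multiple of its mean, so exponential moments
give the fast rate `log (card ι) / n` in expectation (`integral_clippedError_le`).

The resulting `N * log n / n` is turned into `N * log N / n` by `mul_log_div_le_max`; taking `N`
near `n ^ (1 / (1 + 2 * α))` balances the two terms. -/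

/-! ### Factoring real polynomials into short filters with bounded coefficients -/

section Factorization

open Polynomial

/-- Real irreducible factors have degree 1 or 2, so a divisor built up factor by factor cannot skip
two consecutive degrees. Used at `s = S - 1`: each filter has degree at most `S` and removes at
least `S - 1`, whence the divisor `S - 1` in `convDepth`. -/
theorem exists_monic_dvd_natDegree_between {P : ℝ[X]} (hP : P.Monic) :
    ∀ {s : ℕ}, s ≤ P.natDegree →
      ∃ Q : ℝ[X], Q.Monic ∧ Q ∣ P ∧ s ≤ Q.natDegree ∧ Q.natDegree ≤ s + 1
  | 0, _ => ⟨1, monic_one, one_dvd _, by simp, by simp⟩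
  | s + 1, hs => by
    obtain ⟨Q, hQ, ⟨R, rfl⟩, h1, h2⟩ := exists_monic_dvd_natDegree_between hP (s := s) (by omega)
    rcases Nat.lt_or_ge s Q.natDegree with h | h
    · exact ⟨Q, hQ, dvd_mul_right _ _, h, by omega⟩
    have hR : R.Monic := hQ.of_mul_monic_left hP
    rw [hQ.natDegree_mul hR] at hs
    have hu : ¬ IsUnit R := by
      intro hu
      have := natDegree_eq_zero_of_isUnit hu
      omega
    obtain ⟨f, hf, hirr, T, rfl⟩ := R.exists_monic_irreducible_factor hu
    have := hirr.natDegree_le_two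
    have := hirr.natDegree_pos
    refine ⟨Q * f, hQ.mul hf, ⟨T, by ring⟩, ?_, ?_⟩ <;> rw [hQ.natDegree_mul hf] <;> omega

/-- A real monic polynomial of degree at most `K (S - 1)` is a product of `K` monic polynomials of
degree at most `S`, provided that `S ≥ 2`. -/
theorem exists_prod_monic_natDegree_le {S : ℕ} (hS : 2 ≤ S) :
    ∀ (K : ℕ) {P : ℝ[X]}, P.Monic → P.natDegree ≤ K * (S - 1) →
      ∃ p : ℕ → ℝ[X], (∀ j, (p j).Monic ∧ (p j).natDegree ≤ S) ∧ ∏ j ∈ Finset.range K, p j = P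
  | 0, P, hP, h => ⟨fun _ => 1, fun _ => ⟨monic_one, by simp⟩, by
      simp only [Finset.range_zero, Finset.prod_empty]
      exact (hP.natDegree_eq_zero.1 (by omega)).symm⟩
  | K + 1, P, hP, h => by
    have hsplit : ∃ Q R : ℝ[X], Q.Monic ∧ R.Monic ∧ P = R * Q ∧ Q.natDegree ≤ S ∧
        R.natDegree ≤ K * (S - 1) := by
      rcases le_total P.natDegree (S - 1) with h1 | h1
      · exact ⟨P, 1, hP, monic_one, by simp, by omega, by simp⟩
      obtain ⟨Q, hQ, ⟨R, rfl⟩, h2, h3⟩ := exists_monic_dvd_natDegree_between hP h1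
      have hR : R.Monic := hQ.of_mul_monic_left hP
      rw [hQ.natDegree_mul hR, add_mul] at h
      exact ⟨Q, R, hQ, hR, mul_comm _ _, by omega, by omega⟩
    obtain ⟨Q, R, hQ, hR, rfl, hQS, hRK⟩ := hsplit
    obtain ⟨p, hp, hprod⟩ := exists_prod_monic_natDegree_le hS K hR hRK
    refine ⟨Function.update p K Q, fun j => ?_, ?_⟩
    · rcases eq_or_ne j K with rfl | hj
      · simpa using ⟨hQ, hQS⟩
      · simpa [hj] using hp j
    · rw [Finset.prod_range_succ, Function.update_self, ← hprod]
      congr 1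
      refine Finset.prod_congr rfl fun j hj => ?_
      rw [Function.update_of_ne (Finset.mem_range.1 hj).ne]

/-- Coefficients of a monic divisor of a polynomial in terms of its leading coefficient. -/
theorem abs_coeff_le_of_monic_dvd {P Q : ℝ[X]} (hP0 : P ≠ 0) (hP : ∀ i, |P.coeff i| ≤ 1)
    (hQ : Q.Monic) (hQP : Q ∣ P) {S : ℕ} (hQS : Q.natDegree ≤ S) (i : ℕ) :
    |Q.coeff i| ≤ 2 ^ S * (1 + |1 / P.leadingCoeff|) ^ S := by
  set R : ℝ := 1 + |1 / P.leadingCoeff| with hR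
  have hR1 : 1 ≤ R := le_add_of_nonneg_right (abs_nonneg _)
  -- Roots of `Q` are roots of `P`, and Cauchy's bound for `P` is at most `R` because its
  -- coefficients lie in `[-1, 1]`.
  have hroot : ∀ z ∈ (Q.map (algebraMap ℝ ℂ)).roots, ‖z‖ ≤ R := by
    intro z hz
    have hz' : (P.map (algebraMap ℝ ℂ)).IsRoot z :=
      (isRoot_of_mem_roots hz).dvd (Polynomial.map_dvd _ hQP)
    have hne : P.map (algebraMap ℝ ℂ) ≠ 0 := by
      rwa [Ne, Polynomial.map_eq_zero]
    have hlt := hz'.norm_lt_cauchyBound hne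
    have hle : (cauchyBound (P.map (algebraMap ℝ ℂ)) : ℝ) ≤ R := by
      rw [cauchyBound, NNReal.coe_add, NNReal.coe_one, NNReal.coe_div, hR, add_comm]
      have hlead : ((‖(P.map (algebraMap ℝ ℂ)).leadingCoeff‖₊ : NNReal) : ℝ) = |P.leadingCoeff| := by
        simp
      rw [hlead, abs_div, abs_one]
      gcongr
      rw [← NNReal.coe_one, NNReal.coe_le_coe]
      refine Finset.sup_le fun j _ => ?_
      rw [← NNReal.coe_le_coe]
      simpa using hP j
    have hlt' : ‖z‖ < (cauchyBound (P.map (algebraMap ℝ ℂ)) : ℝ) := hlt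
    exact hlt'.le.trans hle
  -- The coefficients of a monic polynomial are, up to sign, elementary symmetric functions of its
  -- roots.
  have hcoeff := coeff_le_of_roots_le (p := Q) (f := algebraMap ℝ ℂ) i hQ
    (IsAlgClosed.splits _) hroot
  have habs : ‖(Q.map (algebraMap ℝ ℂ)).coeff i‖ = |Q.coeff i| := by simp
  rw [habs] at hcoeff
  refine hcoeff.trans ?_
  rw [mul_comm]
  gcongr
  · calc ((Q.natDegree.choose i : ℕ) : ℝ) ≤ ((2 ^ Q.natDegree : ℕ) : ℝ) := by
          exact_mod_cast Nat.choose_le_two_pow _ _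
      _ ≤ 2 ^ S := by push_cast; exact pow_le_pow_right₀ (by norm_num) hQS
  omega

/-- A polynomial with coefficients in `[-1, 1]` factors into `J` filters with bounded
coefficients. -/
theorem exists_filters {S J : ℕ} (hS : 2 ≤ S) (hJ : 0 < J) {P : ℝ[X]} (hP0 : P ≠ 0)
    (hP : ∀ i, |P.coeff i| ≤ 1) (hdeg : P.natDegree ≤ J * (S - 1)) {B : ℝ}
    (hB : 2 ^ S * (1 + |1 / P.leadingCoeff|) ^ S ≤ B) :
    ∃ p : ℕ → ℝ[X], (∀ j, (p j).natDegree ≤ S) ∧ (∀ j < J, ∀ i, |(p j).coeff i| ≤ B) ∧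
      ∏ j ∈ Finset.range J, p j = P := by
  have hl : P.leadingCoeff ≠ 0 := leadingCoeff_ne_zero.2 hP0
  obtain ⟨p, hp, hprod⟩ := exists_prod_monic_natDegree_le hS J
    (monic_mul_leadingCoeff_inv hP0) (by rwa [natDegree_mul_leadingCoeff_inv _ hP0])
  have hdvd : ∀ j < J, p j ∣ P := fun j hj =>
    ((Finset.dvd_prod_of_mem p (Finset.mem_range.2 hj)).trans (dvd_of_eq hprod)).trans
      ⟨C P.leadingCoeff, by rw [mul_assoc, ← C_mul, inv_mul_cancel₀ hl, C_1, mul_one]⟩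
  -- The monic filters multiply to the normalized `P`; the leading coefficient goes back into filter
  -- 0, harmlessly since its modulus is at most 1.
  refine ⟨fun j => if j = 0 then C P.leadingCoeff * p 0 else p j, fun j => ?_, fun j hj i => ?_, ?_⟩
  · dsimp only
    split_ifs
    · exact (natDegree_C_mul_le _ _).trans (hp 0).2
    · exact (hp j).2
  · have hb := (abs_coeff_le_of_monic_dvd hP0 hP (hp j).1 (hdvd j hj) (hp j).2 i).trans hB
    dsimp only
    split_ifs with h
    · subst h
      rw [coeff_C_mul, abs_mul]
      exact (mul_le_of_le_one_left (abs_nonneg _) (hP _)).trans hb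
    · exact hb
  · obtain ⟨J, rfl⟩ : ∃ K, J = K + 1 := ⟨J - 1, by omega⟩
    rw [Finset.prod_range_succ'] at hprod ⊢
    simp only [Nat.add_eq_zero_iff, one_ne_zero, and_false, if_false, if_true]
    rw [mul_left_comm, hprod, mul_left_comm, ← C_mul, mul_inv_cancel₀ hl]
    simp

end Factorization

/-! ### Toeplitz matrices as polynomial multiplication -/

section Toeplitz

open Polynomial

theorem toeplitz_mulVec_coeff {S D : ℕ} (p q : ℝ[X]) (hp : p.natDegree ≤ S)
    (hq : ∀ k, D ≤ k → q.coeff k = 0) (i : Fin (D + S)) :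
    (toeplitz S D fun k => p.coeff k).mulVec (fun k => q.coeff k) i = (p * q).coeff i := by
  -- The guard is needed because `i - k` truncates to `0` for `k > i`. With it, both sides extend by
  -- zero to a sum over `range (D + S)`.
  set F : ℕ → ℝ := fun k => if k ≤ (i : ℕ) then q.coeff k * p.coeff (i - k) else 0 with hF
  have hL : (toeplitz S D fun k => p.coeff k).mulVec (fun k => q.coeff k) i =
      ∑ k ∈ Finset.range D, F k := by
    rw [← Fin.sum_univ_eq_sum_range, Matrix.mulVec, dotProduct]
    refine Finset.sum_congr rfl fun k _ => ?_
    simp only [toeplitz, Matrix.of_apply, hF]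
    by_cases h1 : (k : ℕ) ≤ i
    · by_cases h2 : (i : ℕ) - k ≤ S
      · simp [h1, h2, mul_comm]
      · rw [dif_neg (by tauto), if_pos h1, coeff_eq_zero_of_natDegree_lt (p := p) (by omega)]
        simp
    · simp [h1]
  have hR : (p * q).coeff i = ∑ k ∈ Finset.range (i + 1), F k := by
    rw [mul_comm, coeff_mul, Finset.Nat.sum_antidiagonal_eq_sum_range_succ_mk]
    refine Finset.sum_congr rfl fun k hk => ?_
    rw [hF]
    simp only
    rw [if_pos (by simpa [Nat.lt_succ_iff] using hk)]
  rw [hL, hR]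
  have h1 : ∑ k ∈ Finset.range D, F k = ∑ k ∈ Finset.range (D + S), F k := by
    refine Finset.sum_subset (Finset.range_mono (by omega)) fun k _ hk => ?_
    simp [hF, hq k (by simpa using hk)]
  have h2 : ∑ k ∈ Finset.range (i + 1), F k = ∑ k ∈ Finset.range (D + S), F k := by
    refine Finset.sum_subset (Finset.range_mono (by omega)) fun k _ hk => ?_
    simp only [hF]
    rw [if_neg (by simpa [Nat.lt_succ_iff] using hk)]
  rw [h1, h2]

theorem abs_toeplitz_mulVec_le {S D : ℕ} {w : Fin (S + 1) → ℝ} {v : Fin D → ℝ} {B V : ℝ}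
    (hV : 0 ≤ V) (hw : ∀ k, |w k| ≤ B) (hv : ∀ k, |v k| ≤ V) (i : Fin (D + S)) :
    |(toeplitz S D w).mulVec v i| ≤ ((S : ℝ) + 1) * B * V := by
  have hB : 0 ≤ B := (abs_nonneg _).trans (hw 0)
  -- The band of row `i`: at most `S + 1` entries, since `k ↦ i - k` maps it injectively into `{0,
  -- …, S}`.
  set s : Finset (Fin D) := {k | (k : ℕ) ≤ i ∧ (i : ℕ) - k ≤ S} with hs
  have hcard : s.card ≤ S + 1 := by
    rw [← Finset.card_range (S + 1)]
    refine Finset.card_le_card_of_injOn (fun k => (i : ℕ) - k) ?_ ?_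
    · intro k hk
      have := (Finset.mem_filter.1 hk).2
      simp only [Finset.coe_range, Set.mem_Iio]
      omega
    · intro k hk l hl h
      have := (Finset.mem_filter.1 hk).2
      have := (Finset.mem_filter.1 hl).2
      simp only at h
      ext
      omega
  calc |(toeplitz S D w).mulVec v i| ≤ ∑ k, |toeplitz S D w i k * v k| :=
        Finset.abs_sum_le_sum_abs (fun k => toeplitz S D w i k * v k) Finset.univ
    _ ≤ ∑ k, if k ∈ s then B * V else 0 := by
        refine Finset.sum_le_sum fun k _ => ?_
        simp only [toeplitz, Matrix.of_apply, hs, Finset.mem_filter, Finset.mem_univ, true_and]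
        split_ifs
        · rw [abs_mul]
          exact mul_le_mul (hw _) (hv _) (abs_nonneg _) hB
        · simp
    _ = s.card * (B * V) := by
        rw [Finset.sum_ite_mem, Finset.univ_inter, Finset.sum_const, nsmul_eq_mul]
    _ ≤ ((S : ℝ) + 1) * (B * V) := by
        gcongr
        exact_mod_cast hcard
    _ = _ := by ring

/-- Away from the ends, a row contains the whole filter, so its row sum does not depend on the row.
This makes `linearBias` admissible for the constant-bias constraint. -/
theorem toeplitz_mulVec_one_eq {S D : ℕ} (p : ℝ[X]) (hp : p.natDegree ≤ S) (i : Fin (D + S))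
    (hi : S ≤ (i : ℕ)) (hiD : (i : ℕ) < D) :
    (toeplitz S D fun k => p.coeff k).mulVec (fun _ => 1) i =
      ∑ k ∈ Finset.range (S + 1), p.coeff k := by
  have hq : ∀ k, (ofFn D fun _ => (1 : ℝ)).coeff k = if k < D then 1 else 0 := by
    intro k
    split_ifs with h
    · rw [ofFn_coeff_eq_val_of_lt _ h]
    · rw [ofFn_coeff_eq_zero_of_ge _ (not_lt.1 h)]
  have := toeplitz_mulVec_coeff p (ofFn D fun _ => (1 : ℝ)) hp
    (fun k hk => by rw [hq, if_neg (by omega)]) i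
  have h1 : (fun k : Fin D => (ofFn D fun _ => (1 : ℝ)).coeff k) = fun _ => 1 := by
    ext k
    rw [hq, if_pos k.2]
  rw [h1] at this
  rw [this, coeff_mul, Finset.Nat.sum_antidiagonal_eq_sum_range_succ_mk]
  refine Eq.symm (Finset.sum_subset_zero_on_sdiff (Finset.range_mono (by omega))
    (fun k hk => ?_) fun k _ => ?_)
  · rw [Finset.mem_sdiff, Finset.mem_range, Finset.mem_range] at hk
    simp only
    rw [coeff_eq_zero_of_natDegree_lt (by omega), zero_mul]
  · simp only
    rw [hq, if_pos (by omega), mul_one]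

end Toeplitz

/-! ### Biases that keep the ReLU layers linear -/

section LinearNetwork

open Polynomial

theorem layerWidth_eq (d S j : ℕ) : layerWidth d S j = d + j * S := by
  induction j with
  | zero => simp [layerWidth]
  | succ j ih => rw [layerWidth, ih]; ring

/-- The constant by which the units of layer `j` are shifted into the linear range of the ReLU. -/
noncomputable def layerShift (A : ℝ) (j : ℕ) : ℝ := if j = 0 then 0 else A ^ j

/-- Bias vectors that make every ReLU of the convolutional layers act as the identity. -/
noncomputable def linearBias (d S : ℕ) (p : ℕ → ℝ[X]) (A : ℝ) (j : ℕ)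
    (i : Fin (layerWidth d S (j + 1))) : ℝ :=
  layerShift A j * (toeplitz S (layerWidth d S j) fun k => (p j).coeff k).mulVec (fun _ => 1) i -
    layerShift A (j + 1)

theorem layerShift_nonneg {A : ℝ} (hA : 0 ≤ A) (j : ℕ) : 0 ≤ layerShift A j := by
  unfold layerShift; split_ifs <;> positivity

theorem layerShift_le {A : ℝ} (hA : 0 ≤ A) (j : ℕ) : layerShift A j ≤ A ^ j := by
  unfold layerShift; split_ifs with h
  · positivity
  · exact le_rfl

theorem layerShift_succ (A : ℝ) (j : ℕ) : layerShift A (j + 1) = A ^ (j + 1) := by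
  simp [layerShift]

theorem abs_linearBias_le {d S : ℕ} {p : ℕ → ℝ[X]} {B : ℝ} {j : ℕ}
    (hp : ∀ i, |(p j).coeff i| ≤ B) (i : Fin (layerWidth d S (j + 1))) :
    |linearBias d S p (((S : ℝ) + 1) * B) j i| ≤ 2 * (((S : ℝ) + 1) * B) ^ (j + 1) := by
  have hB : 0 ≤ B := (abs_nonneg _).trans (hp 0)
  set A := ((S : ℝ) + 1) * B with hA
  have hA0 : 0 ≤ A := by positivity
  have hT := abs_toeplitz_mulVec_le (D := layerWidth d S j) (w := fun k => (p j).coeff k)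
    (v := fun _ => 1) zero_le_one (fun k => hp k) (fun _ => by simp) i
  rw [mul_one, ← hA] at hT
  have h0 := layerShift_nonneg hA0 j
  have h1 := layerShift_le hA0 j
  unfold linearBias
  refine (abs_sub _ _).trans ?_
  rw [abs_mul, abs_of_nonneg h0, layerShift_succ, abs_of_nonneg (pow_nonneg hA0 _), two_mul,
    pow_succ]
  gcongr

theorem linearBias_eq {d S : ℕ} {p : ℕ → ℝ[X]} {A : ℝ} {j : ℕ} (hp : (p j).natDegree ≤ S)
    {i i' : Fin (layerWidth d S (j + 1))}
    (hi : S ≤ (i : ℕ)) (hi2 : (i : ℕ) + S < layerWidth d S (j + 1))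
    (hi' : S ≤ (i' : ℕ)) (hi2' : (i' : ℕ) + S < layerWidth d S (j + 1)) :
    linearBias d S p A j i = linearBias d S p A j i' := by
  change _ < layerWidth d S j + S at hi2 hi2'
  unfold linearBias
  rw [toeplitz_mulVec_one_eq _ hp i hi (by omega), toeplitz_mulVec_one_eq _ hp i' hi' (by omega)]

/-- With the biases `linearBias` the convolutional layers multiply the polynomial of the input by
the polynomials of the filters. -/
theorem convOutput_linearBias {d S J : ℕ} {p : ℕ → ℝ[X]} {B : ℝ}
    (hdeg : ∀ j, (p j).natDegree ≤ S) (hp : ∀ j < J, ∀ i, |(p j).coeff i| ≤ B)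
    {x : Fin d → ℝ} (hx : ∀ k, |x k| ≤ 1) {j : ℕ} (hj : j ≤ J) :
    let q := (∏ l ∈ Finset.range j, p l) * ofFn d x
    (∀ k, layerWidth d S j ≤ k → q.coeff k = 0) ∧
    (∀ i : Fin (layerWidth d S j), |q.coeff i| ≤ (((S : ℝ) + 1) * B) ^ j) ∧
    ∀ i : Fin (layerWidth d S j),
      convOutput d S (fun j k => (p j).coeff k) (linearBias d S p (((S : ℝ) + 1) * B)) x j i =
        q.coeff i + layerShift (((S : ℝ) + 1) * B) j := by
  induction j with
  | zero =>
    simp only [Finset.range_zero, Finset.prod_empty, one_mul, pow_zero, layerShift, if_true,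
      add_zero]
    refine ⟨fun k hk => ofFn_coeff_eq_zero_of_ge _ hk, fun i => ?_, fun i => ?_⟩
    · have hi : (i : ℕ) < d := i.2
      rw [ofFn_coeff_eq_val_of_lt _ hi]
      exact hx _
    · have hi : (i : ℕ) < d := i.2
      rw [ofFn_coeff_eq_val_of_lt _ hi]
      rfl
  | succ j ih =>
    obtain ⟨h1, h2, h3⟩ := ih (by omega)
    have hB : 0 ≤ B := (abs_nonneg _).trans (hp j (by omega) 0)
    set A := ((S : ℝ) + 1) * B with hA
    have hA0 : 0 ≤ A := by positivity
    set q := (∏ l ∈ Finset.range j, p l) * ofFn d x with hq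
    have hq' : (∏ l ∈ Finset.range (j + 1), p l) * ofFn d x = p j * q := by
      rw [Finset.prod_range_succ, hq]; ring
    rw [hq']
    have hT := toeplitz_mulVec_coeff (p j) q (hdeg j) h1
    have hb : ∀ i : Fin (layerWidth d S (j + 1)), |(p j * q).coeff i| ≤ A ^ (j + 1) := by
      intro i
      rw [← hT i, pow_succ, mul_comm]
      exact abs_toeplitz_mulVec_le (by positivity) (fun k => hp j (by omega) k) (fun k => h2 k) i
    refine ⟨fun k hk => ?_, hb, fun i => ?_⟩
    · rw [layerWidth] at hk
      rw [coeff_mul]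
      refine Finset.sum_eq_zero fun a ha => ?_
      rw [Finset.HasAntidiagonal.mem_antidiagonal] at ha
      rcases Nat.lt_or_ge S a.1 with h | h
      · rw [coeff_eq_zero_of_natDegree_lt ((hdeg j).trans_lt h), zero_mul]
      · rw [h1 _ (by omega), mul_zero]
    · rw [convOutput]
      have hvec : convOutput d S (fun j k => (p j).coeff k) (linearBias d S p A) x j =
          (fun k : Fin (layerWidth d S j) => q.coeff k) + layerShift A j • fun _ => (1 : ℝ) := by
        ext k
        rw [h3 k]
        simp
      have hlin : ∀ i : Fin (layerWidth d S j + S), (toeplitz S (layerWidth d S j) fun k =>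
          (p j).coeff k).mulVec (convOutput d S (fun j k => (p j).coeff k) (linearBias d S p A) x j)
            i = (p j * q).coeff i + layerShift A j *
              (toeplitz S (layerWidth d S j) fun k => (p j).coeff k).mulVec (fun _ => 1) i := by
        intro i
        rw [hvec, Matrix.mulVec_add, Matrix.mulVec_smul, Pi.add_apply, Pi.smul_apply, hT i,
          smul_eq_mul]
      simp only [reluVec, linearBias, layerShift_succ]
      rw [hlin i]
      -- The coefficient is at least `-A ^ (j + 1)` and the shift is `A ^ (j + 1)`, so the argument
      -- of the ReLU is nonnegative.
      have := (abs_le.1 (hb i)).1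
      rw [max_eq_right] <;> linarith

end LinearNetwork

/-! ### The long filter that computes all inner products -/

section RidgePolynomial

open Polynomial

/-- The long filter that concatenates the reversed directions `ξ 0, …, ξ (m - 1)`. -/
noncomputable def ridgePolynomial {d m : ℕ} (ξ : Fin m → EuclideanSpace ℝ (Fin d)) : ℝ[X] :=
  ofFn (m * d) fun n => ξ n.divNat n.modNat.rev

variable {d m : ℕ} (ξ : Fin m → EuclideanSpace ℝ (Fin d))

theorem ridgePolynomial_coeff (j : Fin m) (k : Fin d) :
    (ridgePolynomial ξ).coeff (((j : ℕ) + 1) * d - 1 - k) = ξ j k := by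
  have hj := j.2
  have hk := k.2
  have hle : ((j : ℕ) + 1) * d ≤ m * d := Nat.mul_le_mul_right _ hj
  have hpos : d ≤ ((j : ℕ) + 1) * d := Nat.le_mul_of_pos_left _ (by omega)
  have hlt : ((j : ℕ) + 1) * d - 1 - k < m * d := by omega
  have heq : ((j : ℕ) + 1) * d - 1 - k = (d - 1 - k) + d * j := by
    rw [add_mul, one_mul, mul_comm] at *
    omega
  have hd : 0 < d := by omega
  have h1 : (⟨((j : ℕ) + 1) * d - 1 - k, hlt⟩ : Fin (m * d)).divNat = j := by
    ext
    simp only [Fin.divNat, heq]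
    rw [Nat.add_mul_div_left _ _ hd, Nat.div_eq_of_lt (by omega), zero_add]
  have h2 : (⟨((j : ℕ) + 1) * d - 1 - k, hlt⟩ : Fin (m * d)).modNat.rev = k := by
    ext
    simp only [Fin.modNat, heq, Fin.val_rev]
    rw [Nat.add_mul_mod_self_left, Nat.mod_eq_of_lt (by omega)]
    omega
  rw [ridgePolynomial, ofFn_coeff_eq_val_of_lt _ hlt, h1, h2]

theorem abs_ridgePolynomial_coeff_le (hξ : ∀ j, ‖ξ j‖ ≤ 1) (i : ℕ) :
    |(ridgePolynomial ξ).coeff i| ≤ 1 := by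
  rcases lt_or_ge i (m * d) with h | h
  · rw [ridgePolynomial, ofFn_coeff_eq_val_of_lt _ h]
    exact (PiLp.norm_apply_le (ξ _) _).trans (hξ _)
  · rw [ridgePolynomial, ofFn_coeff_eq_zero_of_ge _ h]
    simp

/-- Because the directions are reversed, the top block begins, from the highest degree down, with
the first coordinates of the last direction. This is why that direction alone enters the condition
on `B`. -/
theorem ridgePolynomial_leading {k : Fin m} {l : Fin d} (hk : (k : ℕ) + 1 = m)
    (hl : ξ k l ≠ 0) (hlt : ∀ i < l, ξ k i = 0) :
    (ridgePolynomial ξ).leadingCoeff = ξ k l ∧ (ridgePolynomial ξ).natDegree ≤ m * d - 1 := by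
  have hc := ridgePolynomial_coeff ξ k l
  rw [hk] at hc
  have hdeg : (ridgePolynomial ξ).natDegree = m * d - 1 - l := by
    refine natDegree_eq_of_le_of_coeff_ne_zero ?_ (by rwa [hc])
    refine natDegree_le_iff_coeff_eq_zero.2 fun n hn => ?_
    rcases lt_or_ge n (m * d) with h | h
    · have hdm : d ≤ m * d := Nat.le_mul_of_pos_left _ (by omega)
      have hi := ridgePolynomial_coeff ξ k ⟨m * d - 1 - n, by omega⟩
      rw [hk] at hi
      simp only at hi
      rw [show m * d - 1 - (m * d - 1 - n) = n by omega] at hi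
      rw [hi]
      exact hlt _ (by rw [Fin.lt_def]; simp only; omega)
    · rw [ridgePolynomial, ofFn_coeff_eq_zero_of_ge _ h]
  exact ⟨by rw [leadingCoeff, hdeg, hc], by omega⟩

/-- The input has degree below `d`, so this coefficient involves only the block of `ξ j`, and the
reversal turns the convolution into an inner product. Counted from 1 it is entry `(j + 1) * d`, the
one that `fullMatrix` reads. -/
theorem ridgePolynomial_mul_coeff (x : EuclideanSpace ℝ (Fin d)) (j : Fin m) :
    (ridgePolynomial ξ * ofFn d fun i => x i).coeff (((j : ℕ) + 1) * d - 1) = inner ℝ (ξ j) x := by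
  rcases Nat.eq_zero_or_pos d with rfl | hd
  · simp [PiLp.inner_apply]
  have hpos : d ≤ ((j : ℕ) + 1) * d := Nat.le_mul_of_pos_left _ (by omega)
  rw [mul_comm, coeff_mul, Finset.Nat.sum_antidiagonal_eq_sum_range_succ_mk, PiLp.inner_apply]
  rw [← Finset.sum_subset (Finset.range_mono (show d ≤ ((j : ℕ) + 1) * d - 1 + 1 by omega)),
    ← Fin.sum_univ_eq_sum_range
      (fun k => (ofFn d fun i => x i).coeff k * (ridgePolynomial ξ).coeff (((j : ℕ) + 1) * d - 1 - k))]
  · refine Finset.sum_congr rfl fun k _ => ?_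
    rw [ridgePolynomial_coeff, ofFn_coeff_eq_val_of_lt _ k.2]
    simp
  · intro k _ hk
    simp only
    rw [ofFn_coeff_eq_zero_of_ge _ (by simpa using hk), zero_mul]

end RidgePolynomial

/-! ### Linear spline interpolation by ReLU units -/

section Spline

/-- The knots `-1 - 1/N, -1, -1 + 1/N, …, 1, 1 + 1/N`. -/
noncomputable def splineKnot (N i : ℕ) : ℝ := -1 + ((i : ℝ) - 1) / N

/-- The values of `g` at the knots in `[-1, 1]`, and zero at the others. -/
noncomputable def splineValue (g : ℝ → ℝ) (N i : ℕ) : ℝ :=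
  if 1 ≤ i ∧ i ≤ 2 * N + 1 then g (splineKnot N i) else 0

/-- The outer weights of the linear spline that interpolates `g`. -/
noncomputable def splineCoeff (g : ℝ → ℝ) (N i : ℕ) : ℝ :=
  N * (splineValue g N (i + 1) - 2 * splineValue g N i + splineValue g N (i - 1))

variable {g : ℝ → ℝ} {G L α : ℝ} {N : ℕ}

theorem splineKnot_mem (hN : 1 ≤ N) {i : ℕ} (h1 : 1 ≤ i) (h2 : i ≤ 2 * N + 1) :
    splineKnot N i ∈ Set.Icc (-1 : ℝ) 1 := by
  have hN' : (0 : ℝ) < N := by exact_mod_cast hN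
  have h1' : (1 : ℝ) ≤ i := by exact_mod_cast h1
  have h2' : (i : ℝ) ≤ 2 * N + 1 := by exact_mod_cast h2
  unfold splineKnot
  constructor
  · have : 0 ≤ ((i : ℝ) - 1) / N := div_nonneg (by linarith) hN'.le
    linarith
  · have : ((i : ℝ) - 1) / N ≤ 2 := by rw [div_le_iff₀ hN']; linarith
    linarith

theorem abs_splineKnot_le (hN : 1 ≤ N) {i : ℕ} (h2 : i ≤ 2 * N + 2) : |splineKnot N i| ≤ 2 := by
  have hN' : (1 : ℝ) ≤ N := by exact_mod_cast hN
  have h1' : (0 : ℝ) ≤ i := by positivity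
  have h2' : (i : ℝ) ≤ 2 * N + 2 := by exact_mod_cast h2
  unfold splineKnot
  rw [abs_le]
  constructor
  · have : -1 ≤ ((i : ℝ) - 1) / N := by rw [le_div_iff₀ (by linarith)]; linarith
    linarith
  · have : ((i : ℝ) - 1) / N ≤ 3 := by rw [div_le_iff₀ (by linarith)]; linarith
    linarith

theorem abs_splineCoeff_le (hN : 1 ≤ N) (hg : ∀ u ∈ Set.Icc (-1 : ℝ) 1, |g u| ≤ G) (i : ℕ) :
    |splineCoeff g N i| ≤ N * (4 * G) := by
  have hG : 0 ≤ G := (abs_nonneg _).trans (hg 0 (by norm_num))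
  have hv : ∀ i, |splineValue g N i| ≤ G := by
    intro i
    unfold splineValue
    split_ifs with h
    · exact hg _ (splineKnot_mem hN h.1 h.2)
    · simpa
  rw [splineCoeff, abs_mul, Nat.abs_cast]
  gcongr
  have h1 := abs_le.1 (hv (i + 1))
  have h2 := abs_le.1 (hv i)
  have h3 := abs_le.1 (hv (i - 1))
  rw [abs_le]
  constructor <;> linarith

/-- The weights are second differences divided by the mesh `1 / N`; summing them gives slopes, and
summing again gives values. The formula starts correctly at `k = 0` because the value at knot 0 is
zero, also where `i - 1` truncates. -/
theorem splineSum_eq (hN : 1 ≤ N) (u : ℝ) (k : ℕ) :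
    ∑ i ∈ Finset.range (k + 1), splineCoeff g N i * (u - splineKnot N i) =
      splineValue g N k +
        N * (splineValue g N (k + 1) - splineValue g N k) * (u - splineKnot N k) := by
  have hN' : (N : ℝ) ≠ 0 := by positivity
  induction k with
  | zero => simp [splineCoeff, splineValue]
  | succ k ih =>
    rw [Finset.sum_range_succ, ih]
    have hk : splineKnot N (k + 1) = splineKnot N k + 1 / N := by
      simp only [splineKnot]; push_cast; field_simp; ring
    rw [hk, splineCoeff, Nat.add_sub_cancel]
    field_simp
    ring

/-- Piecewise linear interpolation of a Hölder continuous function by a shallow ReLU network. -/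
theorem abs_splineSum_sub_le (hN : 1 ≤ N) (hα : 0 ≤ α)
    (hg : ∀ u ∈ Set.Icc (-1 : ℝ) 1, ∀ v ∈ Set.Icc (-1 : ℝ) 1, |g u - g v| ≤ L * |u - v| ^ α)
    {u : ℝ} (hu : u ∈ Set.Icc (-1 : ℝ) 1) :
    |∑ i ∈ Finset.range (2 * N + 3), splineCoeff g N i * max 0 (u - splineKnot N i) - g u| ≤
      L * (1 / N : ℝ) ^ α := by
  have hN' : (0 : ℝ) < N := by exact_mod_cast hN
  have hL : 0 ≤ L := by
    have := (abs_nonneg _).trans (hg 1 (by norm_num) (-1) (by norm_num))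
    exact nonneg_of_mul_nonneg_left this (by positivity)
  obtain ⟨k, hk1, hk2, hl, hr⟩ : ∃ k, 1 ≤ k ∧ k ≤ 2 * N ∧ splineKnot N k ≤ u ∧
      u ≤ splineKnot N (k + 1) := by
    have h0 : 0 ≤ N * (u + 1) := mul_nonneg hN'.le (by linarith [hu.1])
    have hf := Nat.floor_le h0
    have hf' := Nat.lt_floor_add_one (N * (u + 1))
    unfold splineKnot
    -- The second case is `u = 1`, where the left knot must be moved back so that both neighbours
    -- stay in `[-1, 1]`.
    rcases lt_or_ge ⌊N * (u + 1)⌋₊ (2 * N) with h | h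
    · refine ⟨⌊N * (u + 1)⌋₊ + 1, by omega, by omega, ?_, ?_⟩
      · have : ((⌊N * (u + 1)⌋₊ + 1 : ℕ) - 1 : ℝ) / N ≤ u + 1 := by
          rw [div_le_iff₀ hN']; push_cast; linarith
        linarith
      · have : u + 1 ≤ ((⌊N * (u + 1)⌋₊ + 1 + 1 : ℕ) - 1 : ℝ) / N := by
          rw [le_div_iff₀ hN']; push_cast; linarith
        linarith
    · have hc : (2 * N : ℝ) ≤ ⌊N * (u + 1)⌋₊ := by exact_mod_cast h
      refine ⟨2 * N, by omega, le_rfl, ?_, ?_⟩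
      · have : ((2 * N : ℕ) - 1 : ℝ) / N ≤ u + 1 := by
          rw [div_le_iff₀ hN']; push_cast; linarith
        linarith
      · have : (2 : ℝ) ≤ ((2 * N + 1 : ℕ) - 1 : ℝ) / N := by
          rw [le_div_iff₀ hN']; push_cast; linarith
        linarith [hu.2]
  have hknot : splineKnot N (k + 1) = splineKnot N k + 1 / N := by
    simp only [splineKnot]; push_cast; field_simp; ring
  have hmono : ∀ {i j : ℕ}, i ≤ j → splineKnot N i ≤ splineKnot N j := by
    intro i j hij
    unfold splineKnot
    gcongr
  have hsum : ∑ i ∈ Finset.range (2 * N + 3), splineCoeff g N i * max 0 (u - splineKnot N i) =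
      ∑ i ∈ Finset.range (k + 1), splineCoeff g N i * (u - splineKnot N i) := by
    refine Eq.symm (Finset.sum_subset_zero_on_sdiff (Finset.range_mono (by omega))
      (fun i hi => ?_) fun i hi => ?_)
    · rw [Finset.mem_sdiff, Finset.mem_range, Finset.mem_range] at hi
      have := hmono (show k + 1 ≤ i by omega)
      rw [max_eq_left (by linarith), mul_zero]
    · have := hmono (show i ≤ k by have := Finset.mem_range.1 hi; omega)
      rw [max_eq_right (by linarith)]
  rw [hsum, splineSum_eq hN]
  have hv1 : splineValue g N k = g (splineKnot N k) := if_pos ⟨hk1, by omega⟩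
  have hv2 : splineValue g N (k + 1) = g (splineKnot N (k + 1)) := if_pos ⟨by omega, by omega⟩
  have hd : ∀ i, 1 ≤ i → i ≤ 2 * N + 1 → |splineKnot N i - u| ≤ 1 / N →
      |g (splineKnot N i) - g u| ≤ L * (1 / N : ℝ) ^ α := by
    intro i h1 h2 h3
    refine (hg _ (splineKnot_mem hN h1 h2) _ hu).trans ?_
    gcongr
  have e1 := hd k hk1 (by omega) (by rw [abs_le]; constructor <;> linarith)
  have e2 := hd (k + 1) (by omega) (by omega) (by rw [abs_le]; constructor <;> linarith)
  rw [hv1, hv2]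
  -- The relative position of `u` between its two knots: the error is a convex combination of the
  -- errors at the knots.
  set θ : ℝ := N * (u - splineKnot N k) with hθ
  have hθ0 : 0 ≤ θ := mul_nonneg hN'.le (by linarith)
  have hθ1 : θ ≤ 1 := by
    have : θ ≤ N * (1 / N) := mul_le_mul_of_nonneg_left (by linarith) hN'.le
    rwa [mul_one_div_cancel hN'.ne'] at this
  have hrw : g (splineKnot N k) + N * (g (splineKnot N (k + 1)) - g (splineKnot N k)) *
      (u - splineKnot N k) - g u = (1 - θ) * (g (splineKnot N k) - g u) +
        θ * (g (splineKnot N (k + 1)) - g u) := by rw [hθ]; ring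
  rw [hrw]
  refine (abs_add_le _ _).trans ?_
  rw [abs_mul, abs_mul, abs_of_nonneg hθ0, abs_of_nonneg (sub_nonneg.2 hθ1)]
  nlinarith [mul_le_mul_of_nonneg_left e1 (sub_nonneg.2 hθ1), mul_le_mul_of_nonneg_left e2 hθ0]

end Spline

/-! ### Approximation of additive ridge functions by the networks -/

section Approximation

open Polynomial

theorem le_convDepth_mul {d S m : ℕ} (hS : 2 ≤ S) (hmd : 1 ≤ m * d) :
    m * d - 1 ≤ convDepth d S m * (S - 1) := by
  have hS' : (0 : ℝ) < (S : ℝ) - 1 := by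
    have : (2 : ℝ) ≤ S := by exact_mod_cast hS
    linarith
  have h := Nat.le_ceil (((m : ℝ) * (d : ℝ) - 1) / ((S : ℝ) - 1))
  rw [div_le_iff₀ hS'] at h
  have : ((m * d - 1 : ℕ) : ℝ) ≤ ((convDepth d S m * (S - 1) : ℕ) : ℝ) := by
    rw [Nat.cast_sub hmd, Nat.cast_mul, Nat.cast_mul, Nat.cast_sub (by omega)]
    simpa [convDepth] using h
  exact_mod_cast this

theorem fullMatrix_mulVec {d S J m N : ℕ} (v : Fin (layerWidth d S J) → ℝ)
    (r : Fin m × Fin (2 * N + 3)) (k : Fin (layerWidth d S J))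
    (hk : (k : ℕ) + 1 = ((r.1 : ℕ) + 1) * d) :
    (fullMatrix d S J m N).mulVec v r = v k := by
  rw [Matrix.mulVec, dotProduct, Finset.sum_eq_single k]
  · simp [fullMatrix, hk]
  · intro l _ hl
    have : ¬ (l : ℕ) + 1 = ((r.1 : ℕ) + 1) * d := by
      intro h
      exact hl (Fin.ext (by omega))
    simp [fullMatrix, this]
  · simp

/-- Additive ridge functions are approximated by the networks of `hypothesisSpace` at the rate
`N ^ (-α)`. -/
theorem exists_network_approx {d S m N : ℕ} {α G L B : ℝ} (hS : 2 ≤ S) (hSd : S ≤ d)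
    (hα : 0 ≤ α) (hN : 1 ≤ N) {ξ : Fin m → EuclideanSpace ℝ (Fin d)} {g : Fin m → ℝ → ℝ}
    {f : UnitBall d → ℝ} (hf : IsAdditiveRidge α G L ξ g f) (hB : IsParameterBound S G ξ B) :
    ∃ h ∈ hypothesisSpace d S (convDepth d S m) m N B,
      ∀ x, |h x - f x| ≤ m * (L * (1 / N : ℝ) ^ α) := by
  obtain ⟨k, l, hk, hl, hlt, hmax⟩ := hB
  obtain ⟨hB1, hB2⟩ := max_le_iff.1 hmax
  obtain ⟨hlead, hdeg⟩ := ridgePolynomial_leading ξ hk hl hlt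
  have hmd : d ≤ m * d := Nat.le_mul_of_pos_left _ (by omega)
  set J := convDepth d S m with hJdef
  have hJle := le_convDepth_mul (d := d) (m := m) hS (by omega)
  rw [← hJdef] at hJle
  have hJ : 0 < J := by
    rcases Nat.eq_zero_or_pos J with h | h
    · rw [h] at hJle; omega
    · exact h
  have hP0 : ridgePolynomial ξ ≠ 0 := by
    rw [← leadingCoeff_ne_zero, hlead]; exact hl
  obtain ⟨p, hpdeg, hpB, hprod⟩ := exists_filters hS hJ hP0
    (abs_ridgePolynomial_coeff_le ξ hf.dir_le) (hdeg.trans hJle) (B := B) (by rwa [hlead])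
  have hB1' : 1 ≤ B := by
    refine le_trans ?_ hB1
    have h1 : (1 : ℝ) ≤ 2 ^ S := one_le_pow₀ (by norm_num)
    have h2 : (1 : ℝ) ≤ (1 + |1 / ξ k l|) ^ S :=
      one_le_pow₀ (le_add_of_nonneg_right (abs_nonneg _))
    nlinarith
  set A := ((S : ℝ) + 1) * B with hA
  have hA3 : 3 ≤ A := by
    have : (2 : ℝ) ≤ S := by exact_mod_cast hS
    nlinarith
  have hAJ : 1 ≤ A ^ J := one_le_pow₀ (by linarith)
  -- The output biases remove the shift `A ^ J` of the last convolutional layer and then subtract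
  -- the knot. They satisfy the bound because `A ^ J + 2 ≤ 3 * A ^ J ≤ A ^ (J + 1)`, using `3 ≤ A`.
  refine ⟨networkFun d S J m N (fun j k => (p j).coeff k) (linearBias d S p A)
    (fun r => A ^ J + splineKnot N r.2) (fun r => splineCoeff (g r.1) N r.2),
    ⟨_, _, _, _, fun j hj i => hpB j hj i, fun j hj i => abs_linearBias_le (hpB j hj) i,
      fun j _ i i' h1 h2 h3 h4 => linearBias_eq (hpdeg j) h1 h2 h3 h4, fun r => ?_, fun r => ?_,
      rfl⟩, fun x => ?_⟩
  · have := abs_splineKnot_le hN (show (r.2 : ℕ) ≤ 2 * N + 2 by omega)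
    refine (abs_add_le _ _).trans ?_
    rw [abs_of_nonneg (by linarith), pow_succ]
    nlinarith
  · refine (abs_splineCoeff_le hN (hf.bound r.1) _).trans ?_
    gcongr
  · have hx1 : ‖(x : EuclideanSpace ℝ (Fin d))‖ ≤ 1 := mem_closedBall_zero_iff.1 x.2
    have hx : ∀ k, |(x : EuclideanSpace ℝ (Fin d)) k| ≤ 1 := fun k =>
      (PiLp.norm_apply_le (x : EuclideanSpace ℝ (Fin d)) k).trans hx1
    obtain ⟨-, -, hconv⟩ := convOutput_linearBias hpdeg hpB
      (x := fun i => (x : EuclideanSpace ℝ (Fin d)) i) hx le_rfl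
    rw [hprod, ← hA] at hconv
    have hshift : layerShift A J = A ^ J := if_neg hJ.ne'
    have hu : ∀ j, inner ℝ (ξ j) (x : EuclideanSpace ℝ (Fin d)) ∈ Set.Icc (-1 : ℝ) 1 := by
      intro j
      rw [Set.mem_Icc, ← abs_le]
      refine (abs_real_inner_le_norm _ _).trans ?_
      exact mul_le_one₀ (hf.dir_le j) (norm_nonneg _) hx1
    have hrow : ∀ r : Fin m × Fin (2 * N + 3), (fullMatrix d S J m N).mulVec
        (convOutput d S (fun j k => (p j).coeff k) (linearBias d S p A)
          (fun i => (x : EuclideanSpace ℝ (Fin d)) i) J) r =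
        inner ℝ (ξ r.1) (x : EuclideanSpace ℝ (Fin d)) + A ^ J := by
      intro r
      have h1 : ((r.1 : ℕ) + 1) * d ≤ m * d := Nat.mul_le_mul_right _ r.1.2
      have h2 : d ≤ ((r.1 : ℕ) + 1) * d := Nat.le_mul_of_pos_left _ (by omega)
      have h3 : J * (S - 1) ≤ J * S := Nat.mul_le_mul_left _ (by omega)
      have hw : ((r.1 : ℕ) + 1) * d - 1 < layerWidth d S J := by
        rw [layerWidth_eq]; omega
      rw [fullMatrix_mulVec _ r ⟨_, hw⟩ (by simp only; omega), hconv, hshift]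
      simp only
      rw [ridgePolynomial_mul_coeff]
    rw [networkFun, hf.eq_sum, dotProduct, Fintype.sum_prod_type, ← Finset.sum_sub_distrib]
    refine (Finset.abs_sum_le_sum_abs _ _).trans ?_
    refine (Finset.sum_le_card_nsmul _ _ (L * (1 / N : ℝ) ^ α) fun j _ => ?_).trans_eq (by simp)
    have := abs_splineSum_sub_le hN hα (hf.lipschitz j) (hu j)
    rw [← Fin.sum_univ_eq_sum_range (fun i => splineCoeff (g j) N i *
      max 0 (inner ℝ (ξ j) (x : EuclideanSpace ℝ (Fin d)) - splineKnot N i))] at this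
    refine le_of_eq_of_le ?_ this
    congr 2
    refine Finset.sum_congr rfl fun i _ => ?_
    rw [reluVec, Pi.sub_apply, hrow]
    congr 2
    ring

end Approximation

/-! ### Exponential moments under a variance condition -/

section Concentration

/-- From `exp t ≤ 1 + t + t ^ 2` for `|t| ≤ 1`: the variance condition lets the quadratic term
absorb at most half of the linear one. -/
theorem integral_exp_neg_le {Ω : Type*} [MeasurableSpace Ω] {μ : Measure Ω} [IsProbabilityMeasure μ]
    {ℓ : Ω → ℝ} (hℓ : AEStronglyMeasurable ℓ μ) {b v lam : ℝ} (hb : ∀ᵐ z ∂μ, |ℓ z| ≤ b)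
    (hv : 0 < v) (hvar : ∫ z, ℓ z ^ 2 ∂μ ≤ v * ∫ z, ℓ z ∂μ) (hlam : 0 ≤ lam) (hlb : lam * b ≤ 1)
    (hlv : lam * v ≤ 1 / 2) :
    Integrable (fun z => Real.exp (-(lam * ℓ z))) μ ∧
      ∫ z, Real.exp (-(lam * ℓ z)) ∂μ ≤ Real.exp (-(lam / 2 * ∫ z, ℓ z ∂μ)) := by
  have hint : Integrable ℓ μ := Integrable.of_bound hℓ b hb
  have hint2 : Integrable (fun z => ℓ z ^ 2) μ :=
    Integrable.of_bound (hℓ.pow 2) (b ^ 2) (hb.mono fun z hz => by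
      rw [norm_pow]; exact pow_le_pow_left₀ (norm_nonneg _) hz 2)
  have hbd : ∀ᵐ z ∂μ, |-(lam * ℓ z)| ≤ 1 := hb.mono fun z hz => by
    rw [abs_neg, abs_mul, abs_of_nonneg hlam]
    exact (mul_le_mul_of_nonneg_left hz hlam).trans hlb
  have hexp : Integrable (fun z => Real.exp (-(lam * ℓ z))) μ :=
    Integrable.of_bound (Real.continuous_exp.comp_aestronglyMeasurable (hℓ.const_mul lam).neg)
      (Real.exp 1) (hbd.mono fun z hz => by
        rw [Real.norm_eq_abs, Real.abs_exp]
        exact Real.exp_le_exp.2 ((le_abs_self _).trans hz))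
  refine ⟨hexp, ?_⟩
  have hle : ∀ᵐ z ∂μ, Real.exp (-(lam * ℓ z)) ≤ 1 - lam * ℓ z + lam ^ 2 * ℓ z ^ 2 :=
    hbd.mono fun z hz => by
      have := (abs_le.1 (Real.abs_exp_sub_one_sub_id_le hz)).2
      nlinarith
  have hE : 0 ≤ ∫ z, ℓ z ∂μ := by
    have h0 : 0 ≤ ∫ z, ℓ z ^ 2 ∂μ := integral_nonneg fun z => sq_nonneg _
    exact nonneg_of_mul_nonneg_right (h0.trans hvar) hv
  have hi1 : Integrable (fun z => 1 - lam * ℓ z) μ := (integrable_const 1).sub (hint.const_mul lam)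
  have hi2 : Integrable (fun z => lam ^ 2 * ℓ z ^ 2) μ := hint2.const_mul _
  calc ∫ z, Real.exp (-(lam * ℓ z)) ∂μ ≤ ∫ z, (1 - lam * ℓ z + lam ^ 2 * ℓ z ^ 2) ∂μ :=
        integral_mono_ae hexp (hi1.add hi2) hle
    _ = 1 - lam * ∫ z, ℓ z ∂μ + lam ^ 2 * ∫ z, ℓ z ^ 2 ∂μ := by
        rw [integral_add hi1 hi2, integral_sub (integrable_const 1) (hint.const_mul lam),
          integral_const_mul, integral_const_mul]
        simp
    _ ≤ -(lam / 2 * ∫ z, ℓ z ∂μ) + 1 := by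
        have h1 : lam ^ 2 * ∫ z, ℓ z ^ 2 ∂μ ≤ lam ^ 2 * (v * ∫ z, ℓ z ∂μ) := by gcongr
        have h2 : (lam * ∫ z, ℓ z ∂μ) * (lam * v) ≤ (lam * ∫ z, ℓ z ∂μ) * (1 / 2) := by gcongr
        nlinarith
    _ ≤ _ := Real.add_one_le_exp _

theorem integral_exp_sum_le_one {Ω : Type*} [MeasurableSpace Ω] {μ : Measure Ω}
    [IsProbabilityMeasure μ] {ℓ : Ω → ℝ} (hℓ : AEStronglyMeasurable ℓ μ) {b v lam : ℝ}
    (hb : ∀ᵐ z ∂μ, |ℓ z| ≤ b) (hv : 0 < v) (hvar : ∫ z, ℓ z ^ 2 ∂μ ≤ v * ∫ z, ℓ z ∂μ)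
    (hlam : 0 ≤ lam) (hlb : lam * b ≤ 1) (hlv : lam * v ≤ 1 / 2) (n : ℕ) :
    Integrable (fun D : Fin n → Ω => Real.exp (∑ i, lam * ((∫ z, ℓ z ∂μ) / 2 - ℓ (D i))))
      (Measure.pi fun _ => μ) ∧
    ∫ D : Fin n → Ω, Real.exp (∑ i, lam * ((∫ z, ℓ z ∂μ) / 2 - ℓ (D i))) ∂(Measure.pi fun _ => μ)
      ≤ 1 := by
  obtain ⟨hint, hle⟩ := integral_exp_neg_le hℓ hb hv hvar hlam hlb hlv
  set E := ∫ z, ℓ z ∂μ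
  have heq : ∀ z, Real.exp (lam * (E / 2 - ℓ z)) =
      Real.exp (lam / 2 * E) * Real.exp (-(lam * ℓ z)) := fun z => by
    rw [← Real.exp_add]; congr 1; ring
  have hint' : Integrable (fun z => Real.exp (lam * (E / 2 - ℓ z))) μ := by
    simp_rw [heq]; exact hint.const_mul _
  have hle' : ∫ z, Real.exp (lam * (E / 2 - ℓ z)) ∂μ ≤ 1 := by
    simp_rw [heq]
    rw [integral_const_mul]
    calc _ ≤ Real.exp (lam / 2 * E) * Real.exp (-(lam / 2 * E)) := by gcongr
      _ = 1 := by rw [← Real.exp_add]; simp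
  simp_rw [Real.exp_sum]
  constructor
  · exact Integrable.fintype_prod (f := fun _ z => Real.exp (lam * (E / 2 - ℓ z))) fun _ => hint'
  · rw [integral_fintype_prod_eq_prod (fun _ z => Real.exp (lam * (E / 2 - ℓ z)))]
    exact Finset.prod_le_one (fun _ _ => integral_nonneg fun _ => (Real.exp_pos _).le)
      fun _ _ => hle'

/-- The tangent bound `log t ≤ t - 1` at `t = exp (u k) / card ι`. The right side is free of `k` and
linear in the exponentials, so it bounds the expectation at a data-dependent index, in place of a
union bound. -/
theorem le_log_card_add_sum_exp {ι : Type*} [Fintype ι] (u : ι → ℝ) (k : ι) :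
    u k ≤ Real.log (Fintype.card ι) + (∑ l, Real.exp (u l)) / Fintype.card ι - 1 := by
  have : Nonempty ι := ⟨k⟩
  have hK : (0 : ℝ) < Fintype.card ι := by exact_mod_cast Fintype.card_pos
  have h1 : Real.exp (u k) ≤ ∑ l, Real.exp (u l) :=
    Finset.single_le_sum (f := fun l => Real.exp (u l)) (fun l _ => (Real.exp_pos _).le)
      (Finset.mem_univ k)
  have h2 := Real.log_le_sub_one_of_pos (div_pos (Real.exp_pos (u k)) hK)
  rw [Real.log_div (Real.exp_pos _).ne' hK.ne', Real.log_exp] at h2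
  have h3 : Real.exp (u k) / Fintype.card ι ≤ (∑ l, Real.exp (u l)) / Fintype.card ι := by gcongr
  linarith

end Concentration

/-! ### Truncation of values -/

section Clip

theorem abs_clip_le {X : Type} {M : ℝ} (hM : 0 ≤ M) (f : X → ℝ) (x : X) : |clip M f x| ≤ M :=
  abs_le.2 ⟨le_max_left _ _, max_le (by linarith) (min_le_left _ _)⟩

theorem abs_clip_sub_clip_le {X : Type} (M : ℝ) (f g : X → ℝ) (x : X) :
    |clip M f x - clip M g x| ≤ |f x - g x| := by
  unfold clip
  refine (abs_max_sub_max_le_max _ _ _ _).trans (max_le (by simp) ?_)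
  exact (abs_min_sub_min_le_max _ _ _ _).trans (max_le (by simp) le_rfl)

theorem clip_eq_self {X : Type} {M : ℝ} {f : X → ℝ} {x : X} (h : |f x| ≤ M) :
    clip M f x = f x := by
  rw [abs_le] at h
  rw [clip, min_eq_right h.2, max_eq_right h.1]

theorem Measurable.clip {X : Type} [MeasurableSpace X] {M : ℝ} {f : X → ℝ} (hf : Measurable f) :
    Measurable (clip M f) :=
  measurable_const.max (measurable_const.min hf)

theorem sq_clip_sub_le {X : Type} {M y : ℝ} (f : X → ℝ) (x : X) (hy : |y| ≤ M) :
    (clip M f x - y) ^ 2 ≤ (f x - y) ^ 2 := by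
  have := abs_clip_sub_clip_le M f (fun _ => y) x
  rw [clip_eq_self (f := fun _ : X => y) hy] at this
  exact sq_le_sq.2 this

end Clip

/-! ### Excess risk and the oracle inequality -/

section Oracle

theorem abs_sq_sub_sq_le {a b c M δ : ℝ} (ha : |a| ≤ M) (hb : |b| ≤ M) (hc : |c| ≤ M)
    (hab : |a - b| ≤ δ) : |(a - c) ^ 2 - (b - c) ^ 2| ≤ 4 * M * δ := by
  have h : (a - c) ^ 2 - (b - c) ^ 2 = (a + b - 2 * c) * (a - b) := by ring
  have hδ := (abs_nonneg _).trans hab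
  rw [h, abs_mul]
  rw [abs_le] at ha hb hc
  have h1 : |a + b - 2 * c| ≤ 4 * M := abs_le.2 ⟨by linarith, by linarith⟩
  exact mul_le_mul h1 hab (abs_nonneg _) ((abs_nonneg _).trans h1)

variable {X : Type} [MeasurableSpace X] {ρ : Measure (X × ℝ)}

theorem integral_fst {φ : X → ℝ} (hφ : Measurable φ) :
    ∫ x, φ x ∂ρ.fst = ∫ z, φ z.1 ∂ρ :=
  integral_map measurable_fst.aemeasurable hφ.aestronglyMeasurable

variable [IsProbabilityMeasure ρ]

/-- The truncated conditional mean of the second coordinate given the first. -/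
noncomputable def condMean (ρ : Measure (X × ℝ)) [IsFiniteMeasure ρ] (M : ℝ) : X → ℝ :=
  clip M fun x => ∫ y, y ∂(ρ.condKernel x)

theorem measurable_condMean (M : ℝ) : Measurable (condMean ρ M) := by
  refine Measurable.clip (StronglyMeasurable.measurable ?_)
  exact StronglyMeasurable.integral_kernel (κ := ρ.condKernel)
    (f := fun y : ℝ => y) stronglyMeasurable_id

theorem ae_ae_abs_le {M : ℝ} (hy : ∀ᵐ z ∂ρ, |z.2| ≤ M) :
    ∀ᵐ x ∂ρ.fst, ∀ᵐ y ∂(ρ.condKernel x), |y| ≤ M := by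
  refine Measure.ae_ae_of_ae_compProd (μ := ρ.fst) (κ := ρ.condKernel)
    (p := fun z : X × ℝ => |z.2| ≤ M) ?_
  rwa [ρ.disintegrate ρ.condKernel]

theorem condMean_ae_eq {M : ℝ} (hy : ∀ᵐ z ∂ρ, |z.2| ≤ M) :
    condMean ρ M =ᵐ[ρ.fst] fun x => ∫ y, y ∂(ρ.condKernel x) := by
  filter_upwards [ae_ae_abs_le hy] with x hx
  refine clip_eq_self (f := fun x => ∫ y, y ∂(ρ.condKernel x)) ?_
  simpa using norm_integral_le_of_norm_le_const (μ := ρ.condKernel x) (f := fun y : ℝ => y) hx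

/-- Expanding around the conditional mean leaves a cross term that vanishes after integrating over
`y` given `x`. -/
theorem integral_excess_eq {M : ℝ} (hM : 0 ≤ M) (hy : ∀ᵐ z ∂ρ, |z.2| ≤ M) {u : X → ℝ}
    (hu : Measurable u) {c : ℝ} (huc : ∀ x, |u x| ≤ c) :
    ∫ z, ((u z.1 - z.2) ^ 2 - (condMean ρ M z.1 - z.2) ^ 2) ∂ρ =
      ∫ x, (u x - condMean ρ M x) ^ 2 ∂ρ.fst := by
  set f := condMean ρ M with hf
  have hfm : Measurable f := measurable_condMean M
  have hfb : ∀ x, |f x| ≤ M := abs_clip_le hM _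
  have hub : ∀ x, |u x - f x| ≤ c + M := fun x =>
    (abs_sub _ _).trans (add_le_add (huc x) (hfb x))
  have hi1 : Integrable (fun z : X × ℝ => (u z.1 - f z.1) ^ 2) ρ := by
    refine Integrable.of_bound (C := (c + M) ^ 2) (by fun_prop) (ae_of_all _ fun z => ?_)
    rw [norm_pow]
    exact pow_le_pow_left₀ (norm_nonneg _) (hub _) 2
  have hi2 : Integrable (fun z : X × ℝ => (u z.1 - f z.1) * (f z.1 - z.2)) ρ := by
    refine Integrable.of_bound (C := (c + M) * (M + M)) (by fun_prop) (hy.mono fun z hz => ?_)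
    rw [norm_mul]
    exact mul_le_mul (hub _) ((abs_sub _ _).trans (add_le_add (hfb _) hz)) (norm_nonneg _)
      ((abs_nonneg _).trans (hub z.1))
  have hzero : ∫ z, (u z.1 - f z.1) * (f z.1 - z.2) ∂ρ = 0 := by
    rw [← Measure.integral_condKernel hi2]
    refine integral_eq_zero_of_ae ?_
    filter_upwards [ae_ae_abs_le hy, condMean_ae_eq hy] with x hx hfx
    have hiy : Integrable (fun y : ℝ => y) (ρ.condKernel x) :=
      Integrable.of_bound aestronglyMeasurable_id M hx
    simp only [Pi.zero_apply]
    rw [integral_const_mul, integral_sub (integrable_const _) hiy, ← hfx]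
    simp [hf]
  calc _ = ∫ z, ((u z.1 - f z.1) ^ 2 + 2 * ((u z.1 - f z.1) * (f z.1 - z.2))) ∂ρ := by
        congr 1; ext z; ring
    _ = ∫ z, (u z.1 - f z.1) ^ 2 ∂ρ := by
        rw [integral_add hi1 (hi2.const_mul 2), integral_const_mul, hzero, mul_zero, add_zero]
    _ = _ := (integral_fst (φ := fun x => (u x - f x) ^ 2) (by fun_prop)).symm

/-- Oracle inequality for truncated empirical risk minimizers over a class whose truncations have
a finite `δ`-net `u` in the uniform norm. -/
theorem integral_clippedError_le {M : ℝ} (hM : 0 ≤ M) (hy : ∀ᵐ z ∂ρ, |z.2| ≤ M) {n : ℕ}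
    (hn : 1 ≤ n) {ι : Type*} [Fintype ι] [Nonempty ι] {u : ι → X → ℝ}
    (hu : ∀ k, Measurable (u k)) (hub : ∀ k x, |u k x| ≤ M) {δ : ℝ} {h : X → ℝ} (hh : Measurable h)
    {c : ℝ} (hc : ∀ x, |h x| ≤ c) {ε : ℝ} (hε : ∀ᵐ x ∂ρ.fst, |h x - condMean ρ M x| ≤ ε)
    {fD : (Fin n → X × ℝ) → X → ℝ} (hnet : ∀ D, ∃ k, ∀ x, |clip M (fD D) x - u k x| ≤ δ)
    (hmin : ∀ D, empiricalRisk D (fD D) ≤ empiricalRisk D h) :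
    ∫ D, ∫ x, (clip M (fD D) x - condMean ρ M x) ^ 2 ∂ρ.fst ∂(Measure.pi fun _ : Fin n => ρ) ≤
      2 * (32 * (M + 1) ^ 2 * Real.log (Fintype.card ι) / n + 6 * M * δ + ε ^ 2) := by
  set f := condMean ρ M with hf
  have hfm : Measurable f := measurable_condMean M
  have hfb : ∀ x, |f x| ≤ M := abs_clip_le hM _
  have hn0 : (0 : ℝ) < n := by exact_mod_cast hn
  have : IsProbabilityMeasure ρ.fst := inferInstance
  set ℓ : (X → ℝ) → X × ℝ → ℝ := fun v z => (v z.1 - z.2) ^ 2 - (f z.1 - z.2) ^ 2 with hℓ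
  have hℓm : ∀ {v : X → ℝ}, Measurable v → AEStronglyMeasurable (ℓ v) ρ := by
    intro v hv
    simp only [hℓ]
    fun_prop
  have hℓe : ∀ v z, ℓ v z = (v z.1 - f z.1) * (v z.1 + f z.1 - 2 * z.2) := by
    intro v z; simp only [hℓ]; ring
  have hℓint : ∀ {v : X → ℝ} {c : ℝ}, Measurable v → (∀ x, |v x| ≤ c) → Integrable (ℓ v) ρ := by
    intro v c hv hc
    refine Integrable.of_bound (C := (c + M) * (c + M + 2 * M)) (hℓm hv) (hy.mono fun z hz => ?_)
    have h1 := abs_le.1 (hc z.1)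
    have h2 := abs_le.1 (hfb z.1)
    have h3 := abs_le.1 hz
    rw [hℓe, norm_mul, Real.norm_eq_abs, Real.norm_eq_abs]
    have h4 : |v z.1 - f z.1| ≤ c + M := abs_le.2 ⟨by linarith, by linarith⟩
    exact mul_le_mul h4 (abs_le.2 ⟨by linarith, by linarith⟩) (abs_nonneg _)
      ((abs_nonneg _).trans h4)
  have hE : ∀ {v : X → ℝ} {c : ℝ}, Measurable v → (∀ x, |v x| ≤ c) →
      ∫ z, ℓ v z ∂ρ = ∫ x, (v x - f x) ^ 2 ∂ρ.fst := fun hv hc => integral_excess_eq hM hy hv hc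
  -- Chosen for the bound `8 * (M + 1) ^ 2` on the excess loss and the variance factor `16 * (M + 1)
  -- ^ 2`; using `M + 1` keeps these positive when `M = 0`.
  set lam : ℝ := 1 / (32 * (M + 1) ^ 2) with hlam
  have hlam0 : 0 < lam := by positivity
  set E : ι → ℝ := fun k => ∫ z, ℓ (u k) z ∂ρ with hEdef
  set U : ι → (Fin n → X × ℝ) → ℝ := fun k D => ∑ i, lam * (E k / 2 - ℓ (u k) (D i)) with hU
  have hexp : ∀ k, Integrable (fun D => Real.exp (U k D)) (Measure.pi fun _ : Fin n => ρ) ∧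
      ∫ D, Real.exp (U k D) ∂(Measure.pi fun _ : Fin n => ρ) ≤ 1 := by
    intro k
    have hsq : ∀ᵐ z ∂ρ, ℓ (u k) z ^ 2 ≤ 16 * (M + 1) ^ 2 * (u k z.1 - f z.1) ^ 2 ∧
        |ℓ (u k) z| ≤ 8 * (M + 1) ^ 2 := hy.mono fun z hz => by
      have h1 := abs_le.1 (hub k z.1)
      have h2 := abs_le.1 (hfb z.1)
      have h3 := abs_le.1 hz
      have h4 : |u k z.1 - f z.1| ≤ 2 * (M + 1) := abs_le.2 ⟨by linarith, by linarith⟩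
      have h5 : |u k z.1 + f z.1 - 2 * z.2| ≤ 4 * (M + 1) := abs_le.2 ⟨by linarith, by linarith⟩
      rw [hℓe]
      constructor
      · have h6 : (u k z.1 + f z.1 - 2 * z.2) ^ 2 ≤ (4 * (M + 1)) ^ 2 :=
          sq_le_sq' (abs_le.1 h5).1 (abs_le.1 h5).2
        calc _ = (u k z.1 - f z.1) ^ 2 * (u k z.1 + f z.1 - 2 * z.2) ^ 2 := by ring
          _ ≤ (u k z.1 - f z.1) ^ 2 * (4 * (M + 1)) ^ 2 := by gcongr
          _ = _ := by ring
      · rw [abs_mul]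
        calc _ ≤ (2 * (M + 1)) * (4 * (M + 1)) := by gcongr
          _ = _ := by ring
    refine integral_exp_sum_le_one (hℓm (hu k)) (hsq.mono fun z hz => hz.2)
      (v := 16 * (M + 1) ^ 2) (by positivity) ?_ hlam0.le ?_ ?_ n
    · rw [hE (hu k) (hub k), integral_fst (φ := fun x => (u k x - f x) ^ 2)
        (by have := hu k; fun_prop), ← integral_const_mul]
      refine integral_mono_of_nonneg (ae_of_all _ fun z => sq_nonneg _) ?_
        (hsq.mono fun z hz => hz.1)
      refine Integrable.of_bound (C := 16 * (M + 1) ^ 2 * (2 * M) ^ 2)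
        (by have := hu k; fun_prop) (ae_of_all _ fun z => ?_)
      rw [Real.norm_eq_abs, abs_mul, abs_of_nonneg (by positivity), abs_pow]
      gcongr
      refine (abs_sub _ _).trans ?_
      linarith [hub k z.1, hfb z.1]
    · rw [hlam]; field_simp; norm_num
    · rw [hlam]; field_simp; norm_num
  have hEh : ∫ z, ℓ h z ∂ρ ≤ ε ^ 2 := by
    rw [hE hh hc]
    have h1 : ∀ᵐ x ∂ρ.fst, (h x - f x) ^ 2 ≤ ε ^ 2 := hε.mono fun x hx => by
      rw [← sq_abs]; exact pow_le_pow_left₀ (abs_nonneg _) hx 2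
    calc _ ≤ ∫ _, ε ^ 2 ∂ρ.fst := integral_mono_of_nonneg (ae_of_all _ fun z => sq_nonneg _)
          (integrable_const _) h1
      _ = ε ^ 2 := by simp
  -- A majorant of half the error that involves neither `fD` nor the index of the net. The factor 6
  -- collects `4 * M * δ` from the empirical risk and half of `4 * M * δ` from the true risk.
  set R : (Fin n → X × ℝ) → ℝ := fun D =>
    1 / (lam * n) * (Real.log (Fintype.card ι) - 1 + (∑ k, Real.exp (U k D)) / Fintype.card ι) +
      6 * M * δ + 1 / n * ∑ i, ℓ h (D i) with hR
  have hi1 : Integrable (fun D => 1 / (lam * n) * (Real.log (Fintype.card ι) - 1 +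
      (∑ k, Real.exp (U k D)) / Fintype.card ι) + 6 * M * δ) (Measure.pi fun _ : Fin n => ρ) :=
    (((integrable_const _).add ((integrable_finsetSum _ fun k _ => (hexp k).1).div_const _)).const_mul
      _).add (integrable_const _)
  have hcomp : ∀ i, Integrable (fun D : Fin n → X × ℝ => ℓ h (D i)) (Measure.pi fun _ => ρ) :=
    fun i => (measurePreserving_eval (fun _ : Fin n => ρ) i).integrable_comp_of_integrable
      (hℓint hh hc)
  have hi2 : Integrable (fun D : Fin n → X × ℝ => 1 / n * ∑ i, ℓ h (D i))
      (Measure.pi fun _ => ρ) := (integrable_finsetSum _ fun i _ => hcomp i).const_mul _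
  have hRint : Integrable R (Measure.pi fun _ => ρ) := hi1.add hi2
  have hcard : (0 : ℝ) < Fintype.card ι := by exact_mod_cast Fintype.card_pos
  have hRle : ∫ D, R D ∂(Measure.pi fun _ : Fin n => ρ) ≤
      1 / (lam * n) * Real.log (Fintype.card ι) + 6 * M * δ + ε ^ 2 := by
    have e1 : ∫ D, R D ∂(Measure.pi fun _ : Fin n => ρ) =
        1 / (lam * n) * (Real.log (Fintype.card ι) - 1 +
          (∑ k, ∫ D, Real.exp (U k D) ∂(Measure.pi fun _ : Fin n => ρ)) / Fintype.card ι) +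
        6 * M * δ + 1 / n * ∑ _i : Fin n, ∫ z, ℓ h z ∂ρ := by
      have hs : Integrable (fun D => (∑ k, Real.exp (U k D)) / (Fintype.card ι : ℝ))
          (Measure.pi fun _ : Fin n => ρ) :=
        (integrable_finsetSum _ fun k _ => (hexp k).1).div_const _
      rw [hR, integral_add hi1 hi2, integral_add _ (integrable_const _), integral_const_mul (1 / (lam * n)),
        integral_add (integrable_const _) hs, integral_div,
        integral_finsetSum _ fun k _ => (hexp k).1, integral_const_mul (1 / (n : ℝ)),
        integral_finsetSum _ fun i _ => hcomp i]
      · simp only [integral_const, probReal_univ, one_smul]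
        congr 2
        refine Finset.sum_congr rfl fun i _ => ?_
        exact integral_comp_eval (μ := fun _ : Fin n => ρ) (hℓm hh)
      · exact ((integrable_const _).add hs).const_mul _
    have e2 : (∑ k, ∫ D, Real.exp (U k D) ∂(Measure.pi fun _ : Fin n => ρ)) / Fintype.card ι ≤ 1 := by
      rw [div_le_one hcard]
      calc _ ≤ ∑ _k : ι, (1 : ℝ) := Finset.sum_le_sum fun k _ => (hexp k).2
        _ = _ := by simp
    have e3 : 1 / (n : ℝ) * ∑ _i : Fin n, ∫ z, ℓ h z ∂ρ = ∫ z, ℓ h z ∂ρ := by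
      rw [Finset.sum_const, Finset.card_univ, Fintype.card_fin, nsmul_eq_mul]
      field_simp
    rw [e1, e3]
    have e4 : 1 / (lam * n) * (Real.log (Fintype.card ι) - 1 +
        (∑ k, ∫ D, Real.exp (U k D) ∂(Measure.pi fun _ : Fin n => ρ)) / Fintype.card ι) ≤
        1 / (lam * n) * Real.log (Fintype.card ι) := by
      gcongr
      linarith
    linarith
  have hae : ∀ᵐ D ∂(Measure.pi fun _ : Fin n => ρ), ∀ i, |(D i).2| ≤ M :=
    ae_all_iff.2 fun i =>
      (measurePreserving_eval (fun _ : Fin n => ρ) i).quasiMeasurePreserving.ae hy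
  have hmain : ∀ᵐ D ∂(Measure.pi fun _ : Fin n => ρ),
      ∫ x, (clip M (fD D) x - f x) ^ 2 ∂ρ.fst ≤ 2 * R D := by
    filter_upwards [hae] with D hD
    obtain ⟨k, hk⟩ := hnet D
    have herr : ∫ x, (clip M (fD D) x - f x) ^ 2 ∂ρ.fst ≤ E k + 4 * M * δ := by
      have hint : Integrable (fun x => (u k x - f x) ^ 2) ρ.fst := by
        refine Integrable.of_bound (C := (2 * M) ^ 2) (by have := hu k; fun_prop)
          (ae_of_all _ fun x => ?_)
        rw [norm_pow]
        refine pow_le_pow_left₀ (norm_nonneg _) ((abs_sub _ _).trans ?_) 2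
        linarith [hub k x, hfb x]
      calc _ ≤ ∫ x, ((u k x - f x) ^ 2 + 4 * M * δ) ∂ρ.fst := by
            refine integral_mono_of_nonneg (ae_of_all _ fun z => sq_nonneg _)
              (hint.add (integrable_const _)) (ae_of_all _ fun x => ?_)
            have := (abs_le.1 (abs_sq_sub_sq_le (abs_clip_le hM (fD D) x) (hub k x) (hfb x) (hk x))).2
            simp only
            linarith
        _ = _ := by
            rw [integral_add hint (integrable_const _), hEdef]
            simp only
            rw [hE (hu k) (hub k)]
            simp
    -- Truncation only lowers the empirical risk, since the outputs lie in `[-M, M]`, and the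
    -- minimizer does at least as well as `h`.
    have hemp : 1 / (n : ℝ) * ∑ i, ℓ (u k) (D i) ≤ 1 / n * ∑ i, ℓ h (D i) + 4 * M * δ := by
      have hs : ∑ i, ((u k (D i).1 - (D i).2) ^ 2) ≤
          ∑ i, ((fD D (D i).1 - (D i).2) ^ 2 + 4 * M * δ) := by
        refine Finset.sum_le_sum fun i _ => ?_
        have h1 := (abs_le.1 (abs_sq_sub_sq_le (abs_clip_le hM (fD D) (D i).1) (hub k (D i).1)
          (hD i) (hk (D i).1))).1
        have h2 := sq_clip_sub_le (fD D) (D i).1 (hD i)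
        linarith
      have hm := hmin D
      unfold empiricalRisk at hm
      have hs' := mul_le_mul_of_nonneg_left hs (show 0 ≤ 1 / (n : ℝ) by positivity)
      rw [Finset.sum_add_distrib, Finset.sum_const, Finset.card_univ, Fintype.card_fin,
        nsmul_eq_mul, mul_add] at hs'
      have hcancel : 1 / (n : ℝ) * (n * (4 * M * δ)) = 4 * M * δ := by field_simp
      simp only [hℓ, Finset.sum_sub_distrib, mul_sub]
      linarith
    have hUk := le_log_card_add_sum_exp (fun l => U l D) k
    have hUeq : 1 / (lam * n) * U k D = E k / 2 - 1 / n * ∑ i, ℓ (u k) (D i) := by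
      rw [hU]
      simp only
      rw [← Finset.mul_sum, Finset.sum_sub_distrib, Finset.sum_const, Finset.card_univ,
        Fintype.card_fin, nsmul_eq_mul]
      field_simp
    have hU2 : 1 / (lam * n) * U k D ≤ 1 / (lam * n) * (Real.log (Fintype.card ι) - 1 +
        (∑ k, Real.exp (U k D)) / Fintype.card ι) := by
      gcongr
      linarith
    simp only [hR]
    linarith
  -- Monotonicity for a nonnegative left side asks integrability of the majorant only.
  calc _ ≤ ∫ D, 2 * R D ∂(Measure.pi fun _ : Fin n => ρ) :=
        integral_mono_of_nonneg (ae_of_all _ fun D => integral_nonneg fun x => sq_nonneg _)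
          (hRint.const_mul 2) hmain
    _ ≤ 2 * (1 / (lam * n) * Real.log (Fintype.card ι) + 6 * M * δ + ε ^ 2) := by
        rw [integral_const_mul]
        gcongr
    _ = _ := by
        rw [hlam]
        congr 3
        field_simp

end Oracle

/-! ### Dependence of the networks on their parameters -/

section Stability

theorem toeplitz_sub (S D : ℕ) (w w' : Fin (S + 1) → ℝ) :
    toeplitz S D (w - w') = toeplitz S D w - toeplitz S D w' := by
  ext i k
  simp only [toeplitz, Matrix.of_apply, Matrix.sub_apply]
  split_ifs <;> simp

theorem abs_reluVec_le {ι : Type} (v : ι → ℝ) (i : ι) : |reluVec v i| ≤ |v i| := by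
  simpa [reluVec] using abs_max_sub_max_le_max 0 (v i) 0 0

theorem abs_reluVec_sub_le {ι : Type} (v v' : ι → ℝ) (i : ι) :
    |reluVec v i - reluVec v' i| ≤ |v i - v' i| := by
  simpa [reluVec] using abs_max_sub_max_le_max 0 (v i) 0 (v' i)

/-- The convolutional layers are bounded, and Lipschitz in bounded parameters. -/
theorem exists_convOutput_bound (d S : ℕ) {V : ℝ} (hV : 0 ≤ V) (J : ℕ) :
    ∃ H E : ℝ, 0 ≤ H ∧ 0 ≤ E ∧ ∀ (w w' : ℕ → Fin (S + 1) → ℝ)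
      (b b' : (j : ℕ) → Fin (layerWidth d S (j + 1)) → ℝ) (η : ℝ), 0 ≤ η →
      (∀ j < J, ∀ k, |w j k| ≤ V) → (∀ j < J, ∀ k, |w' j k| ≤ V) → (∀ j < J, ∀ i, |b j i| ≤ V) →
      (∀ j < J, ∀ k, |w j k - w' j k| ≤ η) → (∀ j < J, ∀ i, |b j i - b' j i| ≤ η) →
      ∀ x : Fin d → ℝ, (∀ k, |x k| ≤ 1) →
        (∀ i, |convOutput d S w b x J i| ≤ H) ∧
        ∀ i, |convOutput d S w b x J i - convOutput d S w' b' x J i| ≤ E * η := by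
  induction J with
  | zero =>
    exact ⟨1, 0, zero_le_one, le_rfl, fun w w' b b' η _ _ _ _ _ _ x hx =>
      ⟨hx, fun i => by simp [convOutput]⟩⟩
  | succ J ih =>
    obtain ⟨H, E, hH, hE, h⟩ := ih
    refine ⟨((S : ℝ) + 1) * V * H + V, ((S : ℝ) + 1) * H + ((S : ℝ) + 1) * V * E + 1, by positivity,
      by positivity, fun w w' b b' η hη hw hw' hb hww hbb x hx => ?_⟩
    obtain ⟨h1, h2⟩ := h w w' b b' η hη (fun j hj => hw j (by omega)) (fun j hj => hw' j (by omega))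
      (fun j hj => hb j (by omega)) (fun j hj => hww j (by omega)) (fun j hj => hbb j (by omega)) x hx
    set y := convOutput d S w b x J with hy
    set y' := convOutput d S w' b' x J with hy'
    constructor
    · intro i
      refine (abs_reluVec_le _ _).trans ((abs_sub _ _).trans ?_)
      exact add_le_add (abs_toeplitz_mulVec_le hH (hw J (by omega)) h1 i) (hb J (by omega) i)
    · intro i
      refine (abs_reluVec_sub_le _ _ _).trans ?_
      have hT : ∀ i : Fin (layerWidth d S J + S), (toeplitz S (layerWidth d S J) (w J)).mulVec y i -
          (toeplitz S (layerWidth d S J) (w' J)).mulVec y' i =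
          (toeplitz S (layerWidth d S J) (w J - w' J)).mulVec y i +
            (toeplitz S (layerWidth d S J) (w' J)).mulVec (y - y') i := by
        intro i
        rw [toeplitz_sub, Matrix.sub_mulVec, Matrix.mulVec_sub]
        simp only [Pi.sub_apply]
        ring
      have e1 := abs_toeplitz_mulVec_le hH (fun k => hww J (by omega) k) h1 i
      have e2 := abs_toeplitz_mulVec_le (v := y - y') (by positivity) (hw' J (by omega)) h2 i
      have e3 := hbb J (by omega) i
      calc _ = |((toeplitz S (layerWidth d S J) (w J)).mulVec y i -
          (toeplitz S (layerWidth d S J) (w' J)).mulVec y' i) - (b J i - b' J i)| := by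
            congr 1; ring
        _ ≤ ((S : ℝ) + 1) * η * H + ((S : ℝ) + 1) * V * (E * η) + η := by
            rw [hT i]
            exact (abs_sub _ _).trans (add_le_add ((abs_add_le _ _).trans (add_le_add e1 e2)) e3)
        _ = _ := by ring

theorem abs_fullMatrix_mulVec_le {d S J m N : ℕ} {v : Fin (layerWidth d S J) → ℝ} {V : ℝ}
    (hV : 0 ≤ V) (hv : ∀ k, |v k| ≤ V) (r : Fin m × Fin (2 * N + 3)) :
    |(fullMatrix d S J m N).mulVec v r| ≤ V := by
  by_cases h : ∃ k : Fin (layerWidth d S J), (k : ℕ) + 1 = ((r.1 : ℕ) + 1) * d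
  · obtain ⟨k, hk⟩ := h
    rw [fullMatrix_mulVec v r k hk]
    exact hv k
  · have h0 : (fullMatrix d S J m N).mulVec v r = 0 := by
      rw [Matrix.mulVec, dotProduct]
      refine Finset.sum_eq_zero fun k _ => ?_
      simp only [fullMatrix, Matrix.of_apply]
      rw [if_neg fun hk => h ⟨k, hk⟩, zero_mul]
    rw [h0, abs_zero]
    exact hV

theorem continuous_networkFun (d S J m N : ℕ) (w : ℕ → Fin (S + 1) → ℝ)
    (b : (j : ℕ) → Fin (layerWidth d S (j + 1)) → ℝ) (β c : Fin m × Fin (2 * N + 3) → ℝ) :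
    Continuous (networkFun d S J m N w b β c) := by
  have hconv : ∀ j, Continuous fun x : UnitBall d =>
      convOutput d S w b (fun i => (x : EuclideanSpace ℝ (Fin d)) i) j := by
    intro j
    induction j with
    | zero =>
      simp only [convOutput]
      fun_prop
    | succ j ih =>
      refine continuous_pi fun i => continuous_const.max (Continuous.sub ?_ continuous_const)
      exact (continuous_apply i).comp (continuous_const.matrix_mulVec ih)
  unfold networkFun
  refine continuous_finsetSum _ fun r _ => continuous_const.mul ?_
  refine continuous_const.max (Continuous.sub ?_ continuous_const)
  exact (continuous_apply r).comp (continuous_const.matrix_mulVec (hconv J))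

/-- One factor `N` comes from the number of units in the last hidden layer, the other from the bound
on the outer weights; the convolutional layers contribute constants free of `N`. -/
theorem exists_networkFun_lipschitz (d S J m : ℕ) {V : ℝ} (hV : 0 ≤ V) :
    ∃ Λ : ℝ, 0 ≤ Λ ∧ ∀ N : ℕ, 1 ≤ N → ∀ (w w' : ℕ → Fin (S + 1) → ℝ)
      (b b' : (j : ℕ) → Fin (layerWidth d S (j + 1)) → ℝ) (β β' c c' : Fin m × Fin (2 * N + 3) → ℝ)
      (η : ℝ), 0 ≤ η →
      (∀ j < J, ∀ k, |w j k| ≤ V) → (∀ j < J, ∀ k, |w' j k| ≤ V) → (∀ j < J, ∀ i, |b j i| ≤ V) →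
      (∀ j < J, ∀ k, |w j k - w' j k| ≤ η) → (∀ j < J, ∀ i, |b j i - b' j i| ≤ η) →
      (∀ r, |β r| ≤ V) → (∀ r, |β r - β' r| ≤ η) → (∀ r, |c' r| ≤ N * V) →
      (∀ r, |c r - c' r| ≤ η) →
      ∀ x, |networkFun d S J m N w b β c x - networkFun d S J m N w' b' β' c' x| ≤
        Λ * (N : ℝ) ^ 2 * η := by
  obtain ⟨H, E, hH, hE, h⟩ := exists_convOutput_bound d S hV J
  refine ⟨5 * m * ((H + V) + V * (E + 1)), by positivity, fun N hN w w' b b' β β' c c' η hη hw hw'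
    hb hww hbb hβ hββ hc hcc x => ?_⟩
  have hN' : (1 : ℝ) ≤ N := by exact_mod_cast hN
  have hx1 : ‖(x : EuclideanSpace ℝ (Fin d))‖ ≤ 1 := mem_closedBall_zero_iff.1 x.2
  obtain ⟨h1, h2⟩ := h w w' b b' η hη hw hw' hb hww hbb
    (fun i => (x : EuclideanSpace ℝ (Fin d)) i)
    (fun k => (PiLp.norm_apply_le (x : EuclideanSpace ℝ (Fin d)) k).trans hx1)
  unfold networkFun
  set y := convOutput d S w b (fun i => (x : EuclideanSpace ℝ (Fin d)) i) J
  set y' := convOutput d S w' b' (fun i => (x : EuclideanSpace ℝ (Fin d)) i) J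
  set F := fullMatrix d S J m N with hF
  rw [dotProduct, dotProduct, ← Finset.sum_sub_distrib]
  have hterm : ∀ r, |c r * reluVec (F.mulVec y - β) r - c' r * reluVec (F.mulVec y' - β') r| ≤
      η * (H + V) + N * V * (E * η + η) := by
    intro r
    have e1 : |reluVec (F.mulVec y - β) r| ≤ H + V :=
      (abs_reluVec_le _ _).trans ((abs_sub _ _).trans
        (add_le_add (abs_fullMatrix_mulVec_le hH h1 r) (hβ r)))
    have e2 : |reluVec (F.mulVec y - β) r - reluVec (F.mulVec y' - β') r| ≤ E * η + η := by
      refine (abs_reluVec_sub_le _ _ _).trans ?_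
      have : (F.mulVec y - β) r - (F.mulVec y' - β') r = F.mulVec (y - y') r - (β r - β' r) := by
        rw [Matrix.mulVec_sub]
        simp only [Pi.sub_apply]
        ring
      rw [this]
      exact (abs_sub _ _).trans (add_le_add
        (abs_fullMatrix_mulVec_le (v := y - y') (by positivity) h2 r) (hββ r))
    calc _ = |(c r - c' r) * reluVec (F.mulVec y - β) r +
          c' r * (reluVec (F.mulVec y - β) r - reluVec (F.mulVec y' - β') r)| := by
          congr 1; ring
      _ ≤ _ := by
          refine (abs_add_le _ _).trans ?_
          rw [abs_mul, abs_mul]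
          exact add_le_add (mul_le_mul (hcc r) e1 (abs_nonneg _) hη)
            (mul_le_mul (hc r) e2 (abs_nonneg _) (by positivity))
  refine (Finset.abs_sum_le_sum_abs _ _).trans
    ((Finset.sum_le_card_nsmul _ _ _ fun r _ => hterm r).trans ?_)
  rw [Finset.card_univ, Fintype.card_prod, Fintype.card_fin, Fintype.card_fin, nsmul_eq_mul]
  push_cast
  have e1 : (m : ℝ) * (2 * N + 3) ≤ m * (5 * N) := by gcongr; linarith
  have e2 : η * (H + V) + N * V * (E * η + η) ≤ N * (((H + V) + V * (E + 1)) * η) := by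
    have : η * (H + V) * 1 ≤ η * (H + V) * N := by gcongr
    nlinarith
  calc _ ≤ (m * (5 * N) : ℝ) * (N * (((H + V) + V * (E + 1)) * η)) :=
        mul_le_mul e1 e2 (by positivity) (by positivity)
    _ = _ := by ring

end Stability

/-! ### A finite net for the hypothesis space -/

section Covering

/-- The indices of the free parameters of the networks. -/
abbrev ParamIndex (d S J m N : ℕ) : Type :=
  (Σ j : Fin J, Fin (S + 1) ⊕ Fin (layerWidth d S (j + 1))) ⊕
    ((Fin m × Fin (2 * N + 3)) ⊕ (Fin m × Fin (2 * N + 3)))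

/-- The network with a given list of parameters. -/
noncomputable def paramNetwork (d S J m N : ℕ) (θ : ParamIndex d S J m N → ℝ) : UnitBall d → ℝ :=
  networkFun d S J m N
    (fun j k => if h : j < J then θ (.inl ⟨⟨j, h⟩, .inl k⟩) else 0)
    (fun j i => if h : j < J then θ (.inl ⟨⟨j, h⟩, .inr i⟩) else 0)
    (fun r => θ (.inr (.inl r))) (fun r => θ (.inr (.inr r)))

theorem exists_int_mul_near {V η : ℝ} (hη : 0 < η) {k : ℕ} (hk : V ≤ k * η) {t : ℝ} (ht : |t| ≤ V) :
    ∃ z : Finset.Icc (-(k : ℤ)) k, |t - η * ((z : ℤ) : ℝ)| ≤ η := by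
  obtain ⟨h1, h2⟩ := abs_le.1 (ht.trans hk)
  have h3 : -(k : ℝ) ≤ t / η := by rw [le_div_iff₀ hη]; linarith
  have h4 : t / η ≤ k := by rw [div_le_iff₀ hη]; linarith
  refine ⟨⟨⌊t / η⌋, Finset.mem_Icc.2 ⟨?_, ?_⟩⟩, ?_⟩
  · rw [Int.le_floor]; push_cast; exact h3
  · have := (Int.floor_le (t / η)).trans h4
    exact_mod_cast this
  · have h5 := Int.floor_le (t / η)
    have h6 := (Int.lt_floor_add_one (t / η)).le
    rw [le_div_iff₀ hη] at h5
    rw [div_le_iff₀ hη] at h6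
    simp only
    exact abs_le.2 ⟨by linarith, by linarith⟩

/-- The hypothesis space has a `1 / n`-net in the uniform norm whose logarithmic cardinality is
linear in the number of units of the fully connected layer, up to logarithms. -/
theorem exists_net (d S J m : ℕ) {B : ℝ} (hB : 0 ≤ B) :
    ∃ E : ℝ, 0 ≤ E ∧ ∀ N n : ℕ, 1 ≤ N → 1 ≤ n →
      ∃ (ι : Type) (_ : Fintype ι) (_ : Nonempty ι) (u : ι → UnitBall d → ℝ),
        (∀ k, Continuous (u k)) ∧
        (∀ f ∈ hypothesisSpace d S J m N B, ∃ k, ∀ x, |f x - u k x| ≤ 1 / n) ∧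
        Real.log (Fintype.card ι) ≤ E * N * (1 + Real.log N + Real.log n) := by
  set A : ℝ := ((S : ℝ) + 1) * B with hA
  have hA0 : 0 ≤ A := by positivity
  set V : ℝ := B + 2 * (A + 1) ^ (J + 1) with hV
  have hV0 : 0 ≤ V := by positivity
  have hBV : B ≤ V := le_add_of_nonneg_right (by positivity)
  have hbV : ∀ j ≤ J, 2 * A ^ (j + 1) ≤ V := by
    intro j hj
    have h1 : A ^ (j + 1) ≤ (A + 1) ^ (j + 1) := by gcongr; linarith
    have h2 : (A + 1) ^ (j + 1) ≤ (A + 1) ^ (J + 1) :=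
      pow_le_pow_right₀ (by linarith) (by omega)
    linarith
  -- Rounding can push a parameter out of its range by at most `η ≤ 1`, hence `V + 1`.
  obtain ⟨Λ, hΛ, hlip⟩ := exists_networkFun_lipschitz d S J m (V := V + 1) (by linarith)
  set P : ℕ := Fintype.card (Σ j : Fin J, Fin (S + 1) ⊕ Fin (layerWidth d S (j + 1))) with hP
  set Q : ℝ := 2 * V * (Λ + 1) + 3 with hQ
  have hQ1 : 1 ≤ Q := by
    have : 0 ≤ 2 * V * (Λ + 1) := by positivity
    linarith
  have hlogQ : 0 ≤ Real.log Q := Real.log_nonneg hQ1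
  refine ⟨(P + 10 * m) * (Real.log Q + 3), by positivity, fun N n hN hn => ?_⟩
  have hN' : (1 : ℝ) ≤ N := by exact_mod_cast hN
  have hn' : (1 : ℝ) ≤ n := by exact_mod_cast hn
  set η : ℝ := 1 / ((Λ + 1) * (N : ℝ) ^ 2 * n) with hη
  have hη0 : 0 < η := by positivity
  have hη1 : η ≤ 1 := by
    rw [hη, div_le_one (by positivity)]
    have : (1 : ℝ) ≤ (N : ℝ) ^ 2 := one_le_pow₀ hN'
    exact one_le_mul_of_one_le_of_one_le
      (one_le_mul_of_one_le_of_one_le (by linarith) this) hn'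
  set k : ℕ := ⌈N * V / η⌉₊ with hk
  have hkV : N * V ≤ k * η := by
    rw [← div_le_iff₀ hη0]; exact Nat.le_ceil _
  refine ⟨ParamIndex d S J m N → Finset.Icc (-(k : ℤ)) k, inferInstance,
    ⟨fun _ => ⟨0, by simp⟩⟩,
    fun z => paramNetwork d S J m N fun i => η * ((z i : ℤ) : ℝ),
    fun z => continuous_networkFun _ _ _ _ _ _ _ _ _, ?_, ?_⟩
  -- The constant-bias constraint is dropped: the net need not lie in the hypothesis space, and the
  -- extra parameters number a constant independent of `N`.
  · rintro f ⟨w, b, β, c, hw, hb, -, hβ, hc, rfl⟩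
    have hwV : ∀ j < J, ∀ i, |w j i| ≤ V := fun j hj i => (hw j hj i).trans hBV
    have hbV' : ∀ j < J, ∀ i, |b j i| ≤ V := fun j hj i => (hb j hj i).trans (hbV j hj.le)
    have hβV : ∀ r, |β r| ≤ V := fun r => (hβ r).trans (hbV J le_rfl)
    have hcV : ∀ r, |c r| ≤ N * V := fun r => (hc r).trans (by gcongr)
    have hVN : V ≤ N * V := le_mul_of_one_le_left hV0 hN'
    set θ : ParamIndex d S J m N → ℝ := fun i => match i with
      | .inl ⟨j, .inl k⟩ => w j k
      | .inl ⟨j, .inr i⟩ => b j i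
      | .inr (.inl r) => β r
      | .inr (.inr r) => c r with hθ
    have hθV : ∀ i, |θ i| ≤ N * V := by
      rintro (⟨j, k | i⟩ | r | r)
      · exact (hwV j j.2 k).trans hVN
      · exact (hbV' j j.2 i).trans hVN
      · exact (hβV r).trans hVN
      · exact hcV r
    choose z hz using fun i => exists_int_mul_near hη0 hkV (hθV i)
    refine ⟨z, fun x => ?_⟩
    have hnear : ∀ {s t W : ℝ}, |s| ≤ W → |s - t| ≤ η → |t| ≤ W + 1 := by
      intro s t W hs hst
      rw [abs_le] at *
      constructor <;> linarith
    have := hlip N hN w (fun j k => if h : j < J then η * ((z (.inl ⟨⟨j, h⟩, .inl k⟩) : ℤ) : ℝ) else 0)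
      b (fun j i => if h : j < J then η * ((z (.inl ⟨⟨j, h⟩, .inr i⟩) : ℤ) : ℝ) else 0)
      β (fun r => η * ((z (.inr (.inl r)) : ℤ) : ℝ)) c (fun r => η * ((z (.inr (.inr r)) : ℤ) : ℝ))
      η hη0.le (fun j hj i => (hwV j hj i).trans (by linarith))
      (fun j hj i => by
        rw [dif_pos hj]
        exact hnear (hwV j hj i) (hz (.inl ⟨⟨j, hj⟩, .inl i⟩)))
      (fun j hj i => (hbV' j hj i).trans (by linarith))
      (fun j hj i => by
        rw [dif_pos hj]
        exact hz (.inl ⟨⟨j, hj⟩, .inl i⟩))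
      (fun j hj i => by
        rw [dif_pos hj]
        exact hz (.inl ⟨⟨j, hj⟩, .inr i⟩))
      (fun r => (hβV r).trans (by linarith)) (fun r => hz (.inr (.inl r)))
      (fun r => (hnear (hcV r) (hz (.inr (.inr r)))).trans (by linarith))
      (fun r => hz (.inr (.inr r))) x
    refine this.trans ?_
    rw [hη, mul_one_div, div_le_div_iff₀ (by positivity) (by positivity)]
    have : 0 ≤ (N : ℝ) ^ 2 * n := by positivity
    linarith
  · have hcard : Fintype.card (ParamIndex d S J m N → Finset.Icc (-(k : ℤ)) k) =
        (2 * k + 1) ^ (P + 2 * (m * (2 * N + 3))) := by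
      rw [Fintype.card_fun, Fintype.card_coe, Int.card_Icc, Fintype.card_sum, Fintype.card_sum,
        Fintype.card_prod, Fintype.card_fin, Fintype.card_fin, ← hP]
      congr 1 <;> omega
    rw [hcard, Nat.cast_pow, Real.log_pow]
    -- The range `N * V` over the mesh `η` costs `N ^ 3 * n`, which is polynomial and so only
    -- logarithmic in the entropy.
    have h1 : ((2 * k + 1 : ℕ) : ℝ) ≤ Q * (N : ℝ) ^ 3 * n := by
      have h2 := (Nat.ceil_lt_add_one (show 0 ≤ N * V / η by positivity)).le
      rw [← hk] at h2
      have h3 : N * V / η = V * (Λ + 1) * ((N : ℝ) ^ 3 * n) := by rw [hη]; field_simp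
      have h4 : (1 : ℝ) ≤ (N : ℝ) ^ 3 * n :=
        one_le_mul_of_one_le_of_one_le (one_le_pow₀ hN') hn'
      rw [h3] at h2
      push_cast
      rw [hQ]
      nlinarith
    have hlog : Real.log ((2 * k + 1 : ℕ) : ℝ) ≤ Real.log Q + 3 * Real.log N + Real.log n := by
      refine (Real.log_le_log (by positivity) h1).trans_eq ?_
      rw [Real.log_mul (by positivity) (by positivity), Real.log_mul (by positivity) (by positivity),
        Real.log_pow]
      push_cast
      ring
    have hlN := Real.log_nonneg hN'
    have hln := Real.log_nonneg hn'
    have h2 : Real.log ((2 * k + 1 : ℕ) : ℝ) ≤ (Real.log Q + 3) * (1 + Real.log N + Real.log n) := by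
      nlinarith [mul_nonneg hlogQ hlN, mul_nonneg hlogQ hln]
    have h3 : ((P + 2 * (m * (2 * N + 3)) : ℕ) : ℝ) ≤ (P + 10 * m) * N := by
      push_cast
      have e1 : (P : ℝ) * 1 ≤ P * N := by gcongr
      have e2 : (m : ℝ) * (2 * N + 3) ≤ m * (5 * N) := by gcongr; linarith
      linarith
    calc _ ≤ ((P + 10 * m) * N : ℝ) * ((Real.log Q + 3) * (1 + Real.log N + Real.log n)) :=
          mul_le_mul h3 h2 (Real.log_nonneg (by push_cast; linarith [Nat.cast_nonneg (α := ℝ) k]))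
            (by positivity)
      _ = _ := by ring

end Covering

/-! ### Elementary comparison of rates -/

section Rates

/-- If `n ≤ N ^ 6`, then `log n ≤ 6 * log N`. Otherwise `N ^ 3 ≤ √n` and `log n ≤ 2 * √n` make the
left side at most `2 * N ^ (-2)`, which the approximation term dominates because `α ≤ 1`. -/
theorem mul_log_div_le_max {α : ℝ} (hα1 : α ≤ 1) {n N : ℕ} (hn : 1 ≤ n) (hN : 1 ≤ N) :
    (N : ℝ) * Real.log n / n ≤ 6 * max ((N : ℝ) ^ (-2 * α)) ((N : ℝ) * Real.log N / n) := by
  have hN' : (1 : ℝ) ≤ N := by exact_mod_cast hN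
  have hn' : (1 : ℝ) ≤ n := by exact_mod_cast hn
  rcases le_total (Real.log n) (6 * Real.log N) with h | h
  · calc (N : ℝ) * Real.log n / n ≤ N * (6 * Real.log N) / n := by gcongr
      _ = 6 * (N * Real.log N / n) := by ring
      _ ≤ _ := by gcongr; exact le_max_right _ _
  · have h6 : (N : ℝ) ^ 6 ≤ n := by
      rw [← Real.log_le_log_iff (by positivity) (by positivity), Real.log_pow]
      exact_mod_cast h
    have h3 : (N : ℝ) ^ 3 ≤ Real.sqrt n := by
      rw [Real.le_sqrt (by positivity) (by positivity)]
      calc _ = (N : ℝ) ^ 6 := by ring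
        _ ≤ n := h6
    have hs : Real.sqrt n * Real.sqrt n = n := Real.mul_self_sqrt (by positivity)
    have hl : Real.log n ≤ 2 * Real.sqrt n := by
      have h1 := Real.log_le_sub_one_of_pos (Real.sqrt_pos.2 (show (0 : ℝ) < n by positivity))
      rw [Real.log_sqrt (by positivity)] at h1
      linarith
    have hln : 0 ≤ Real.log n := Real.log_nonneg hn'
    have hpow : ((N : ℝ) ^ 2)⁻¹ ≤ (N : ℝ) ^ (-2 * α) := by
      rw [← Real.rpow_natCast, ← Real.rpow_neg (by positivity)]
      exact Real.rpow_le_rpow_of_exponent_le hN' (by push_cast; linarith)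
    calc (N : ℝ) * Real.log n / n = (N : ℝ) ^ 3 * Real.log n / n * ((N : ℝ) ^ 2)⁻¹ := by
          field_simp
      _ ≤ Real.sqrt n * (2 * Real.sqrt n) / n * ((N : ℝ) ^ 2)⁻¹ := by gcongr
      _ = 2 * ((N : ℝ) ^ 2)⁻¹ := by
          rw [mul_left_comm, hs]; field_simp
      _ ≤ 6 * (N : ℝ) ^ (-2 * α) := by
          have := Real.rpow_nonneg (show (0 : ℝ) ≤ N by positivity) (-2 * α)
          linarith
      _ ≤ _ := by gcongr; exact le_max_left _ _

theorem div_le_max {α : ℝ} {n N : ℕ} (hN : 2 ≤ N) :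
    (N : ℝ) / n ≤ 2 * max ((N : ℝ) ^ (-2 * α)) ((N : ℝ) * Real.log N / n) := by
  have hN' : (2 : ℝ) ≤ N := by exact_mod_cast hN
  have hl : 1 / 2 ≤ Real.log N := by
    have := Real.log_le_log (by norm_num) hN'
    linarith [Real.log_two_gt_d9]
  calc (N : ℝ) / n = 2 * (N * (1 / 2) / n) := by ring
    _ ≤ 2 * (N * Real.log N / n) := by gcongr
    _ ≤ _ := by gcongr; exact le_max_right _ _

/-- The power `p` solves `p ^ (-2 * α) = p / n`, and `N` lies between `p` and `2 * p`. -/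
theorem max_le_of_eq_ceil {α : ℝ} (hα : 0 < α) {n N : ℕ} (hn : 2 ≤ n)
    (hN : N = ⌈(n : ℝ) ^ (1 / (1 + 2 * α))⌉₊) :
    max ((N : ℝ) ^ (-2 * α)) ((N : ℝ) * Real.log N / n) ≤
      2 * ((n : ℝ) ^ (-2 * α / (1 + 2 * α)) * Real.log n) := by
  have hn' : (2 : ℝ) ≤ n := by exact_mod_cast hn
  have hn0 : (0 : ℝ) < n := by linarith
  set p : ℝ := (n : ℝ) ^ (1 / (1 + 2 * α)) with hp
  have hp1 : 1 ≤ p := Real.one_le_rpow (by linarith) (by positivity)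
  have hpn : p ≤ n := by
    have := Real.rpow_le_rpow_of_exponent_le (show (1 : ℝ) ≤ n by linarith)
      (show 1 / (1 + 2 * α) ≤ 1 by rw [div_le_one (by linarith)]; linarith)
    rwa [Real.rpow_one] at this
  have hNp : p ≤ N := by rw [hN]; exact Nat.le_ceil _
  have hN2 : (N : ℝ) ≤ 2 * p := by
    have := (Nat.ceil_lt_add_one (show 0 ≤ p by linarith)).le
    rw [← hN] at this
    linarith
  have hNn : (N : ℝ) ≤ n := by
    have : N ≤ n := by rw [hN]; exact Nat.ceil_le.2 hpn
    exact_mod_cast this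
  have hl : 1 / 2 ≤ Real.log n := by
    have := Real.log_le_log (by norm_num) hn'
    linarith [Real.log_two_gt_d9]
  have hr : p ^ (-2 * α) = (n : ℝ) ^ (-2 * α / (1 + 2 * α)) := by
    rw [hp, ← Real.rpow_mul hn0.le]; congr 1; ring
  have hr2 : p / n = (n : ℝ) ^ (-2 * α / (1 + 2 * α)) := by
    rw [hp, ← Real.rpow_sub_one hn0.ne']; congr 1; field_simp; ring
  refine max_le ?_ ?_
  · calc (N : ℝ) ^ (-2 * α) ≤ p ^ (-2 * α) :=
          Real.rpow_le_rpow_of_nonpos (by linarith) hNp (by linarith)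
      _ = 2 * ((n : ℝ) ^ (-2 * α / (1 + 2 * α)) * (1 / 2)) := by rw [hr]; ring
      _ ≤ _ := by gcongr
  · calc (N : ℝ) * Real.log N / n ≤ (2 * p) * Real.log n / n := by
          gcongr
          linarith
      _ = 2 * (p / n * Real.log n) := by ring
      _ = _ := by rw [hr2]

end Rates

/-! ### Assembling the risk bound -/

section Risk

variable {d S m n N : ℕ} {α M L B G : ℝ} {ρ : Measure (UnitBall d × ℝ)}
  [IsProbabilityMeasure ρ] {ξ : Fin m → EuclideanSpace ℝ (Fin d)} {g : Fin m → ℝ → ℝ}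
  {f : UnitBall d → ℝ} {fD : (Fin n → UnitBall d × ℝ) → UnitBall d → ℝ}

theorem one_le_of_isParameterBound (hB : IsParameterBound S G ξ B) : 1 ≤ B := by
  obtain ⟨k, l, -, -, -, h⟩ := hB
  refine le_trans ?_ ((le_max_left _ _).trans h)
  have h1 : (1 : ℝ) ≤ 2 ^ S := one_le_pow₀ (by norm_num)
  have h2 : (1 : ℝ) ≤ (1 + |1 / ξ k l|) ^ S := one_le_pow₀ (le_add_of_nonneg_right (abs_nonneg _))
  exact one_le_mul_of_one_le_of_one_le h1 h2

theorem nonneg_of_ae_abs_le (hy : ∀ᵐ z ∂ρ, |z.2| ≤ M) : 0 ≤ M := by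
  obtain ⟨z, hz⟩ := hy.exists
  exact (abs_nonneg _).trans hz

theorem IsAdditiveRidge.holder_nonneg (hm : 1 ≤ m) (hf : IsAdditiveRidge α G L ξ g f) : 0 ≤ L := by
  have := (abs_nonneg _).trans
    (hf.lipschitz ⟨0, hm⟩ 1 (by norm_num) (-1) (by norm_num))
  exact nonneg_of_mul_nonneg_left this (by positivity)

theorem clippedError_eq (hy : ∀ᵐ z ∂ρ, |z.2| ≤ M) (hf : IsRegressionFunction ρ f)
    (D : Fin n → UnitBall d × ℝ) :
    clippedError ρ M f fD D = ∫ x, (clip M (fD D) x - condMean ρ M x) ^ 2 ∂ρ.fst := by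
  refine integral_congr_ae ?_
  filter_upwards [hf, condMean_ae_eq hy] with x h1 h2
  rw [h1, h2]

theorem abs_clippedError_le (hy : ∀ᵐ z ∂ρ, |z.2| ≤ M) (hf : IsRegressionFunction ρ f)
    (D : Fin n → UnitBall d × ℝ) : |clippedError ρ M f fD D| ≤ 4 * M ^ 2 := by
  have hM := nonneg_of_ae_abs_le hy
  rw [clippedError_eq hy hf]
  have : ∀ᵐ x ∂ρ.fst, ‖(clip M (fD D) x - condMean ρ M x) ^ 2‖ ≤ (2 * M) ^ 2 :=
    ae_of_all _ fun x => by
      rw [norm_pow]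
      refine pow_le_pow_left₀ (norm_nonneg _) ((abs_sub _ _).trans ?_) 2
      have h1 := abs_clip_le hM (fD D) x
      have h2 : |condMean ρ M x| ≤ M := abs_clip_le hM _ x
      linarith
  have h := norm_integral_le_of_norm_le_const this
  simp only [Real.norm_eq_abs, probReal_univ, mul_one] at h
  linarith

theorem integral_clippedError_le_const (hy : ∀ᵐ z ∂ρ, |z.2| ≤ M) (hf : IsRegressionFunction ρ f) :
    ∫ D, clippedError ρ M f fD D ∂(sampleLaw ρ n) ≤ 4 * M ^ 2 := by
  have : IsProbabilityMeasure (sampleLaw ρ n) := by unfold sampleLaw; infer_instance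
  have h := norm_integral_le_of_norm_le_const (μ := sampleLaw ρ n) (f := clippedError ρ M f fD)
    (ae_of_all _ fun D => abs_clippedError_le hy hf D)
  rw [probReal_univ, mul_one] at h
  exact (le_abs_self _).trans h

theorem integrable_clippedError (hy : ∀ᵐ z ∂ρ, |z.2| ≤ M) (hf : IsRegressionFunction ρ f)
    (hmeas : AEStronglyMeasurable (clippedError ρ M f fD) (sampleLaw ρ n)) :
    Integrable (clippedError ρ M f fD) (sampleLaw ρ n) := by
  have : IsProbabilityMeasure (sampleLaw ρ n) := by unfold sampleLaw; infer_instance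
  exact Integrable.of_bound hmeas (4 * M ^ 2) (ae_of_all _ fun D => abs_clippedError_le hy hf D)

/-- The risk bound in terms of the approximation error and the metric entropy. -/
theorem exists_risk_bound (d S m : ℕ) (hS : 2 ≤ S) (hSd : S ≤ d) {α M L B : ℝ} (hα : 0 < α)
    (hB0 : 0 ≤ B) :
    ∃ E : ℝ, 0 ≤ E ∧ ∀ (ρ : Measure (UnitBall d × ℝ)) [IsProbabilityMeasure ρ]
      (G : ℝ) (ξ : Fin m → EuclideanSpace ℝ (Fin d)) (g : Fin m → ℝ → ℝ) (f : UnitBall d → ℝ),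
      (∀ᵐ z ∂ρ, |z.2| ≤ M) → IsRegressionFunction ρ f → IsAdditiveRidge α G L ξ g f →
      IsParameterBound S G ξ B → ∀ n N : ℕ, 1 ≤ n → 1 ≤ N →
      ∀ fD : (Fin n → UnitBall d × ℝ) → UnitBall d → ℝ,
        IsEmpiricalMinimizer (hypothesisSpace d S (convDepth d S m) m N B) fD →
        ∫ D, clippedError ρ M f fD D ∂(sampleLaw ρ n) ≤
          2 * (32 * (M + 1) ^ 2 * (E * N * (1 + Real.log N + Real.log n)) / n + 6 * M * (1 / n) +
            (m * L) ^ 2 * (N : ℝ) ^ (-2 * α)) := by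
  obtain ⟨E, hE, hnet⟩ := exists_net d S (convDepth d S m) m hB0
  refine ⟨E, hE, fun ρ _ G ξ g f hy hreg hf hB n N hn hN fD hfD => ?_⟩
  have hM := nonneg_of_ae_abs_le hy
  obtain ⟨ι, _, _, u, hu, hcov, hlog⟩ := hnet N n hN hn
  obtain ⟨h, hh, happ⟩ := exists_network_approx hS hSd hα.le hN hf hB
  have hhc : Continuous h := by
    obtain ⟨w, b, β, c, -, -, -, -, -, rfl⟩ := hh
    exact continuous_networkFun _ _ _ _ _ _ _ _ _
  obtain ⟨c, hc⟩ : ∃ c, ∀ x, |h x| ≤ c := by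
    have : CompactSpace (UnitBall d) := isCompact_iff_compactSpace.1 (isCompact_closedBall _ _)
    obtain ⟨c, hc⟩ := (isCompact_univ (X := UnitBall d)).exists_bound_of_continuousOn hhc.continuousOn
    exact ⟨c, fun x => hc x (Set.mem_univ x)⟩
  have hε : ∀ᵐ x ∂ρ.fst, |h x - condMean ρ M x| ≤ m * (L * (1 / N : ℝ) ^ α) := by
    filter_upwards [hreg, condMean_ae_eq hy] with x h1 h2
    rw [h2, ← h1]
    exact happ x
  have hmain := integral_clippedError_le hM hy hn (u := fun k => clip M (u k)) (δ := 1 / n) (fD := fD)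
    (fun k => (hu k).measurable.clip) (fun k => abs_clip_le hM _) hhc.measurable hc hε
    (fun D => by
      obtain ⟨k, hk⟩ := hcov _ (hfD D).1
      exact ⟨k, fun x => (abs_clip_sub_clip_le M _ _ x).trans (hk x)⟩)
    (fun D => (hfD D).2 h hh)
  have hpow : (m * (L * (1 / N : ℝ) ^ α)) ^ 2 = (m * L) ^ 2 * (N : ℝ) ^ (-2 * α) := by
    rw [← mul_assoc, mul_pow, one_div, Real.inv_rpow (by positivity), ← Real.rpow_neg (by positivity),
      ← Real.rpow_mul_natCast (by positivity)]
    congr 2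
    push_cast
    ring
  rw [hpow] at hmain
  simp_rw [clippedError_eq hy hreg]
  refine hmain.trans ?_
  gcongr

end Risk

/-- An arbitrary selection of minimizers may fail to be measurable; the measurability assumption
makes the error integrable, so that its integral is a genuine expectation. -/
theorem theorem3 (d S m : ℕ) (α M L B : ℝ) (hS : 2 ≤ S) (hSd : S ≤ d) (hm : 1 ≤ m)
    (hα : 0 < α) (hα1 : α ≤ 1) :
    ∃ C : ℝ, ∀ (ρ : Measure (UnitBall d × ℝ)) [IsProbabilityMeasure ρ]
      (G : ℝ) (ξ : Fin m → EuclideanSpace ℝ (Fin d)) (g : Fin m → ℝ → ℝ) (f : UnitBall d → ℝ),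
      (∀ᵐ z ∂ρ, |z.2| ≤ M) →
      IsRegressionFunction ρ f →
      IsAdditiveRidge α G L ξ g f →
      IsParameterBound S G ξ B →
      (∀ n N : ℕ, 1 ≤ n → 1 ≤ N →
        ∀ fD : (Fin n → UnitBall d × ℝ) → UnitBall d → ℝ,
          IsEmpiricalMinimizer (hypothesisSpace d S (convDepth d S m) m N B) fD →
          AEStronglyMeasurable (clippedError ρ M f fD) (sampleLaw ρ n) →
          Integrable (clippedError ρ M f fD) (sampleLaw ρ n) ∧
          ∫ D, clippedError ρ M f fD D ∂(sampleLaw ρ n) ≤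
            C * max ((N : ℝ) ^ (-2 * α)) ((N : ℝ) * Real.log N / n)) ∧
      (∀ n N : ℕ, 2 ≤ n → N = ⌈(n : ℝ) ^ (1 / (1 + 2 * α))⌉₊ →
        ∀ fD : (Fin n → UnitBall d × ℝ) → UnitBall d → ℝ,
          IsEmpiricalMinimizer (hypothesisSpace d S (convDepth d S m) m N B) fD →
          AEStronglyMeasurable (clippedError ρ M f fD) (sampleLaw ρ n) →
          Integrable (clippedError ρ M f fD) (sampleLaw ρ n) ∧
          ∫ D, clippedError ρ M f fD D ∂(sampleLaw ρ n) ≤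
            C * (n : ℝ) ^ (-2 * α / (1 + 2 * α)) * Real.log n) := by
  -- If one of these signs fails, the hypotheses on `ρ`, `f` and `B` are contradictory and any
  -- constant works.
  by_cases hpos : 0 ≤ B ∧ 0 ≤ M ∧ 0 ≤ L
  swap
  · exact ⟨0, fun ρ _ G ξ g f hy _ hf hB => absurd ⟨zero_le_one.trans (one_le_of_isParameterBound hB),
      nonneg_of_ae_abs_le hy, hf.holder_nonneg hm⟩ hpos⟩
  obtain ⟨hB0, hM, hL⟩ := hpos
  obtain ⟨E, hE, hrisk⟩ := exists_risk_bound d S m hS hSd (M := M) (L := L) hα hB0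
  -- Here `4 * M ^ 2` serves `N = 1`, and `288 = 32 * 9` with `9 = 2 + 1 + 6` from the three parts
  -- of the entropy term. The constant `2 * K` leaves room for the factor 2 of `max_le_of_eq_ceil`.
  set K : ℝ := 4 * M ^ 2 + 2 * (288 * (M + 1) ^ 2 * E + 12 * M + (m * L) ^ 2) with hK
  have hK0 : 0 ≤ K := by positivity
  refine ⟨2 * K, fun ρ _ G ξ g f hy hreg hf hB => ?_⟩
  have hbound : ∀ n N : ℕ, 1 ≤ n → 1 ≤ N → ∀ fD : (Fin n → UnitBall d × ℝ) → UnitBall d → ℝ,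
      IsEmpiricalMinimizer (hypothesisSpace d S (convDepth d S m) m N B) fD →
      ∫ D, clippedError ρ M f fD D ∂(sampleLaw ρ n) ≤
        K * max ((N : ℝ) ^ (-2 * α)) ((N : ℝ) * Real.log N / n) := by
    intro n N hn hN fD hfD
    set X : ℝ := max ((N : ℝ) ^ (-2 * α)) ((N : ℝ) * Real.log N / n) with hX
    have hX0 : 0 ≤ X := (Real.rpow_nonneg (Nat.cast_nonneg N) _).trans (le_max_left _ _)
    -- At `N = 1` the term with `log N` vanishes, but `N ^ (-2 * α) = 1`, so the trivial bound on
    -- the error suffices.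
    rcases Nat.lt_or_ge N 2 with h | h
    · obtain rfl : N = 1 := by omega
      have hX1 : 1 ≤ X := by
        refine le_trans ?_ (le_max_left _ _)
        simp
      calc _ ≤ 4 * M ^ 2 := integral_clippedError_le_const hy hreg
        _ ≤ K := le_add_of_nonneg_right (by positivity)
        _ ≤ K * X := le_mul_of_one_le_right hK0 hX1
    · have hn0 : (0 : ℝ) < n := by exact_mod_cast hn
      have e1 : (N : ℝ) * Real.log n / n ≤ 6 * X := mul_log_div_le_max hα1 hn hN
      have e2 : (N : ℝ) / n ≤ 2 * X := div_le_max h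
      have e3 : (N : ℝ) * Real.log N / n ≤ X := le_max_right _ _
      have e4 : (N : ℝ) ^ (-2 * α) ≤ X := le_max_left _ _
      have e5 : 1 / (n : ℝ) ≤ 2 * X := by
        refine le_trans ?_ e2
        gcongr
        exact_mod_cast hN
      have e6 : 32 * (M + 1) ^ 2 * (E * N * (1 + Real.log N + Real.log n)) / n ≤
          32 * (M + 1) ^ 2 * E * (9 * X) := by
        calc _ = 32 * (M + 1) ^ 2 * E *
              ((N : ℝ) / n + N * Real.log N / n + N * Real.log n / n) := by ring
          _ ≤ _ := by gcongr; linarith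
      refine (hrisk ρ G ξ g f hy hreg hf hB n N hn hN fD hfD).trans ?_
      have e7 : 6 * M * (1 / (n : ℝ)) ≤ 6 * M * (2 * X) := by gcongr
      have e8 : (m * L) ^ 2 * (N : ℝ) ^ (-2 * α) ≤ (m * L) ^ 2 * X := by gcongr
      have e9 : 0 ≤ 4 * M ^ 2 * X := by positivity
      rw [hK]
      linarith
  refine ⟨fun n N hn hN fD hfD hmeas => ⟨integrable_clippedError hy hreg hmeas, ?_⟩,
    fun n N hn hN fD hfD hmeas => ⟨integrable_clippedError hy hreg hmeas, ?_⟩⟩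
  · refine (hbound n N hn hN fD hfD).trans ?_
    have hX0 : 0 ≤ max ((N : ℝ) ^ (-2 * α)) ((N : ℝ) * Real.log N / n) :=
      (Real.rpow_nonneg (Nat.cast_nonneg N) _).trans (le_max_left _ _)
    gcongr
    linarith
  · have hN1 : 1 ≤ N := by
      rw [hN]
      exact Nat.one_le_ceil_iff.2 (Real.rpow_pos_of_pos (by positivity) _)
    calc _ ≤ K * max ((N : ℝ) ^ (-2 * α)) ((N : ℝ) * Real.log N / n) :=
          hbound n N (by omega) hN1 fD hfD
      _ ≤ K * (2 * ((n : ℝ) ^ (-2 * α / (1 + 2 * α)) * Real.log n)) := by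
          gcongr
          exact max_le_of_eq_ceil hα hn hN
      _ = _ := by ring
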